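/- Let $n\ge 1$ and consider the complete graph on $n$ nodes. Initially exactly one node is informed (knows a rumor). Time proceeds in rounds; informed nodes stay informed. In a round, a calling node calls a node chosen uniformly at random among all $n$ nodes (itself included), and the call is successful with probability $p$; all targets and successes, of all nodes and rounds, are independent. In the \emph{push} protocol, every node called successfully by a node that was informed at the beginning of the round becomes informed. In the \emph{pull} protocol, every uninformed node that successfully calls a node that was informed at the beginning of the round becomes informed. In the \emph{push-pull} protocol all nodes call, and an uninformed node becomes informed if either of these two events happens. The rumor spreading time $T$ is the first $t\ge 0$ such that all nodes are informed after $t$ rounds. Below, $p$ is a constant, and $O(1)$ denotes a quantity bounded, for all $n\ge1$ and all initial nodes, by a constant that depends only on $p$ and the protocol; in particular all these expectations are finite. For a round starting with a non-empty set of informed nodes and with $u=n-k$ uninformed ones, let $1-p_{n-u}$ be the probability that a given uninformed node stays uninformed, and let $c_{n-u}$ be the smallest upper bound on the covariances $\operatorname{Cov}[X_1,X_2]$, where $X_1,X_2$ are the indicators of the events that two given distinct uninformed nodes become informed. The \emph{upper (lower) exponential shrinking conditions} with rate $\rho>0$ hold if there are $0<g<1$ and $a,c\ge0$, with $e^{-\rho}+ag<1$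 in the upper case, such that for all sufficiently large $n$ and all $u\le gn$ we have $1-p_{n-u}\le e^{-\rho}+a\frac un$ (respectively $1-p_{n-u}\ge e^{-\rho}-a\frac un$) and $c_{n-u}\le \frac cu$. The \emph{upper double exponential shrinking conditions} hold if there are $0<g\le1$, $\ell>1$ and $a,c\ge0$ with $ag^{\ell-1}<1$ such that for all sufficiently large $n$ and all $u\in[1,gn]$ with $u<n$ we have $1-p_{n-u}\le a(\frac un)^{\ell-1}$ and $c_{n-u}\le c\frac n{u^2}$. \textbf{Theorem.} \begin{enumerate} \item For $0<p\le1$, the push protocol satisfies $\mathbb E[T]=\log_{1+p}n+\frac1p\ln n\pm O(1)$, and it satisfies the upper and the lower exponential shrinking conditions with rate $\rho=p$. \item For $0<p<1$, the pull protocol satisfies $\mathbb E[T]=\log_{1+p}n+\frac1{\ln\frac1{1-p}}\ln n\pm O(1)$. It satisfies the upper and the lower exponential shrinking conditions with rate $\rho=\ln\frac1{1-p}$, and it does not satisfy the upper double exponential shrinking conditions. \item For $0<p<1$, the push-pull protocol satisfies $\mathbb E[T]=\log_{1+2p}n+\frac1{p+\ln\frac1{1-p}}\ln n\pm O(1)$.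 It satisfies the upper and the lower exponential shrinking conditions with rate $\rho=p+\ln\frac1{1-p}$, and it does not satisfy the upper double exponential shrinking conditions. \end{enumerate} -/

import Mathlib

open MeasureTheory ProbabilityTheory Filter

/-! Randomized rumor spreading on the complete graph with nodes `Fin n`. -/

/-- The three classic rumor spreading protocols. -/
inductive SpreadingProtocol : Type
  | push
  | pull
  | pushPull

/-- The calls of one round: node `v` calls the node `(c v).1`, and the call is successful
if `(c v).2 = true`. -/
abbrev Calls (n : ℕ) : Type := Fin n → Fin n × Bool

/-- The law of a single call: the target is uniform among all `n` nodes (the caller included)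
and, independently, the call is successful with probability `p`. -/
noncomputable def callLaw (n : ℕ) (p : unitInterval) : Measure (Fin n × Bool) :=
  (uniformOn (Set.univ : Set (Fin n))).prod (bernoulliMeasure true false p)

instance callLaw.instIsProbabilityMeasure (n : ℕ) [NeZero n] (p : unitInterval) :
    IsProbabilityMeasure (callLaw n p) := by
  have : IsProbabilityMeasure (uniformOn (Set.univ : Set (Fin n))) :=
    isProbabilityMeasure_uniformOn Set.finite_univ Set.univ_nonempty
  unfold callLaw
  infer_instance

/-- The law of the calls of one round: all nodes call independently. -/
noncomputable def roundLaw (n : ℕ) (p : unitInterval) : Measure (Calls n) :=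
  Measure.pi (fun _ : Fin n => callLaw n p)

instance roundLaw.instIsProbabilityMeasure (n : ℕ) [NeZero n] (p : unitInterval) :
    IsProbabilityMeasure (roundLaw n p) := by
  unfold roundLaw
  infer_instance

/-- The law of the calls of all rounds: the rounds are independent; `ω t` are the calls
of the round number `t + 1`. -/
noncomputable def processLaw (n : ℕ) [NeZero n] (p : unitInterval) : Measure (ℕ → Calls n) :=
  Measure.infinitePi (fun _ : ℕ => roundLaw n p)

open Classical in
/-- The nodes that receive the rumor via push: those called successfully by an informed node. -/
noncomputable def pushed {n : ℕ} (S : Finset (Fin n)) (c : Calls n) : Finset (Fin n) :=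
  Finset.univ.filter (fun x => ∃ v ∈ S, c v = (x, true))

open Classical in
/-- The nodes that receive the rumor via pull: those that successfully call an informed node. -/
noncomputable def pulled {n : ℕ} (S : Finset (Fin n)) (c : Calls n) : Finset (Fin n) :=
  Finset.univ.filter (fun x => ∃ v ∈ S, c x = (v, true))

namespace SpreadingProtocol

/-- The set of informed nodes after a round that started with the set `S` of informed nodes
and in which the calls were `c`. -/
noncomputable def step (P : SpreadingProtocol) {n : ℕ} (S : Finset (Fin n)) (c : Calls n) :
    Finset (Fin n) :=
  match P with
  | push => S ∪ pushed S c
  | pull => S ∪ pulled S c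
  | pushPull => S ∪ (pushed S c ∪ pulled S c)

/-- The set of informed nodes after `t` rounds, when initially only `v₀` is informed. -/
noncomputable def informed (P : SpreadingProtocol) {n : ℕ} (v₀ : Fin n) (ω : ℕ → Calls n) :
    ℕ → Finset (Fin n)
  | 0 => {v₀}
  | t + 1 => P.step (P.informed v₀ ω t) (ω t)

/-- The rumor spreading time: the first `t` such that all nodes are informed after `t` rounds
(`⊤` if there is none). -/
noncomputable def spreadingTime (P : SpreadingProtocol) {n : ℕ} (v₀ : Fin n)
    (ω : ℕ → Calls n) : ℕ∞ :=
  ⨅ (t : ℕ) (_ : P.informed v₀ ω t = Finset.univ), (t : ℕ∞)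

/-- The expected rumor spreading time. -/
noncomputable def expectedTime (P : SpreadingProtocol) (p : unitInterval) {n : ℕ} [NeZero n]
    (v₀ : Fin n) : ENNReal :=
  ∫⁻ ω, ((P.spreadingTime v₀ ω : ℕ∞) : ENNReal) ∂(processLaw n p)

/-- `E[T] = f n ± O(1)`: the expected rumor spreading time is finite and differs from `f n` by
at most a constant that depends neither on `n` nor on the starting node. -/
def ExpectedTimeEq (P : SpreadingProtocol) (p : unitInterval) (f : ℕ → ℝ) : Prop :=
  ∃ C : ℝ, ∀ (n : ℕ) [NeZero n] (v₀ : Fin n),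
    P.expectedTime p v₀ ≠ ⊤ ∧ |(P.expectedTime p v₀).toReal - f n| ≤ C

/-- The probability that the node `x` is uninformed after a round that started with the set `S`
of informed nodes. -/
noncomputable def stayProb (P : SpreadingProtocol) (p : unitInterval) {n : ℕ}
    (S : Finset (Fin n)) (x : Fin n) : ℝ :=
  (roundLaw n p).real {c | x ∉ P.step S c}

open Classical in
/-- The indicator random variable of the event that `x` is informed after a round that started
with the set `S` of informed nodes. -/
noncomputable def informedIndicator (P : SpreadingProtocol) {n : ℕ} (S : Finset (Fin n))
    (x : Fin n) (c : Calls n) : ℝ :=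
  if x ∈ P.step S c then 1 else 0

/-- The covariance of the indicators for `x` and `y` in a round that started with the set `S`
of informed nodes. -/
noncomputable def roundCov (P : SpreadingProtocol) (p : unitInterval) {n : ℕ}
    (S : Finset (Fin n)) (x y : Fin n) : ℝ :=
  covariance (P.informedIndicator S x) (P.informedIndicator S y) (roundLaw n p)

/-- The upper exponential shrinking conditions with rate `ρ`. The number of uninformed nodes
is `Sᶜ.card`. -/
def UpperExpShrinking (P : SpreadingProtocol) (p : unitInterval) (ρ : ℝ) : Prop :=
  0 < ρ ∧ ∃ g a c : ℝ, 0 < g ∧ g < 1 ∧ 0 ≤ a ∧ 0 ≤ c ∧ Real.exp (-ρ) + a * g < 1 ∧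
    ∀ᶠ n : ℕ in atTop, ∀ S : Finset (Fin n), S.Nonempty → (Sᶜ.card : ℝ) ≤ g * n →
      (∀ x ∉ S, P.stayProb p S x ≤ Real.exp (-ρ) + a * ((Sᶜ.card : ℝ) / n)) ∧
      (∀ x ∉ S, ∀ y ∉ S, x ≠ y → P.roundCov p S x y ≤ c / (Sᶜ.card : ℝ))

/-- The lower exponential shrinking conditions with rate `ρ`. -/
def LowerExpShrinking (P : SpreadingProtocol) (p : unitInterval) (ρ : ℝ) : Prop :=
  0 < ρ ∧ ∃ g a c : ℝ, 0 < g ∧ g < 1 ∧ 0 ≤ a ∧ 0 ≤ c ∧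
    ∀ᶠ n : ℕ in atTop, ∀ S : Finset (Fin n), S.Nonempty → (Sᶜ.card : ℝ) ≤ g * n →
      (∀ x ∉ S, Real.exp (-ρ) - a * ((Sᶜ.card : ℝ) / n) ≤ P.stayProb p S x) ∧
      (∀ x ∉ S, ∀ y ∉ S, x ≠ y → P.roundCov p S x y ≤ c / (Sᶜ.card : ℝ))

/-- The upper double exponential shrinking conditions (for some values of their parameters). -/
def UpperDoubleExpShrinking (P : SpreadingProtocol) (p : unitInterval) : Prop :=
  ∃ g l a c : ℝ, 0 < g ∧ g ≤ 1 ∧ 1 < l ∧ 0 ≤ a ∧ 0 ≤ c ∧ a * g ^ (l - 1) < 1 ∧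
    ∀ᶠ n : ℕ in atTop, ∀ S : Finset (Fin n), S.Nonempty → (Sᶜ.card : ℝ) ≤ g * n →
      (∀ x ∉ S, P.stayProb p S x ≤ a * ((Sᶜ.card : ℝ) / n) ^ (l - 1)) ∧
      (∀ x ∉ S, ∀ y ∉ S, x ≠ y → P.roundCov p S x y ≤ c * (n / (Sᶜ.card : ℝ) ^ 2))

end SpreadingProtocol

namespace SpreadingProtocol

/-- The success probability of the push calls. -/
noncomputable def pushRate (P : SpreadingProtocol) (p : unitInterval) : ℝ :=
  match P with
  | push => p
  | pull => 0
  | pushPull => p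

/-- The success probability of the pull calls. -/
noncomputable def pullRate (P : SpreadingProtocol) (p : unitInterval) : ℝ :=
  match P with
  | push => 0
  | pull => p
  | pushPull => p

end SpreadingProtocol

theorem callLaw_real_success {n : ℕ} [NeZero n] (p : unitInterval) (B : Finset (Fin n)) :
    (callLaw n p).real {e | e.2 = true ∧ e.1 ∈ B} = p * B.card / n := by
  have h : {e : Fin n × Bool | e.2 = true ∧ e.1 ∈ B} = (B : Set (Fin n)) ×ˢ {true} := by
    ext e; simp [and_comm]
  have hB : (uniformOn (Set.univ : Set (Fin n))).real (B : Set (Fin n)) = B.card / n := by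
    rw [measureReal_def, uniformOn_univ, Measure.count_apply_finset]
    simp
  rw [h, callLaw, measureReal_prod_prod, hB,
    bernoulliMeasure_real_apply_of_mem_of_notMem _ (by measurability) (Set.mem_singleton _)
      (fun h => Bool.false_ne_true (Set.mem_singleton_iff.mp h))]
  ring

theorem callLaw_real_no_success {n : ℕ} [NeZero n] (p : unitInterval) (B : Finset (Fin n)) :
    (callLaw n p).real {e | ¬ (e.2 = true ∧ e.1 ∈ B)} = 1 - p * B.card / n := by
  rw [← callLaw_real_success p B]
  exact probReal_compl_eq_one_sub (μ := callLaw n p) (s := {e | e.2 = true ∧ e.1 ∈ B})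
    (Set.toFinite _).measurableSet

namespace SpreadingProtocol

/-- The outcomes of the call of `v` that inform no node of `A` when `S` is informed. -/
def avoiding (P : SpreadingProtocol) {n : ℕ} (S A : Finset (Fin n)) (v : Fin n) :
    Set (Fin n × Bool) :=
  {e | (P ≠ pull → v ∈ S → ¬ (e.2 = true ∧ e.1 ∈ A)) ∧
    (P ≠ push → v ∈ A → ¬ (e.2 = true ∧ e.1 ∈ S))}

theorem avoiding_eq_pi (P : SpreadingProtocol) {n : ℕ} {S A : Finset (Fin n)}
    (hA : Disjoint S A) :
    {c | ∀ x ∈ A, x ∉ P.step S c} = Set.univ.pi (P.avoiding S A) := by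
  have hA' : ∀ x ∈ A, x ∉ S := fun x hx hS => Finset.disjoint_left.mp hA hS hx
  ext c
  simp only [Set.mem_ofPred_eq, Set.mem_pi, Set.mem_univ, true_imp_iff, avoiding]
  cases P
  · simp only [step, pushed, Finset.mem_union, Finset.mem_filter, Finset.mem_univ, true_and,
      ne_eq, reduceCtorEq, not_false_eq_true, true_imp_iff, not_true, false_imp_iff, and_true]
    constructor
    · rintro h v hv ⟨h2, h1⟩
      exact h _ h1 (Or.inr ⟨v, hv, by ext <;> simp [h2]⟩)
    · rintro h x hx (hS | ⟨v, hv, hc⟩)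
      · exact hA' x hx hS
      · exact h v hv (by simp [hc, hx])
  · simp only [step, pulled, Finset.mem_union, Finset.mem_filter, Finset.mem_univ, true_and,
      ne_eq, reduceCtorEq, not_false_eq_true, true_imp_iff, not_true, false_imp_iff]
    constructor
    · rintro h v hv ⟨h2, h1⟩
      exact h _ hv (Or.inr ⟨_, h1, by ext <;> simp [h2]⟩)
    · rintro h x hx (hS | ⟨v, hv, hc⟩)
      · exact hA' x hx hS
      · exact h x hx (by simp [hc, hv])
  · simp only [step, pulled, pushed, Finset.mem_union, Finset.mem_filter, Finset.mem_univ,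
      true_and, ne_eq, reduceCtorEq, not_false_eq_true, true_imp_iff]
    constructor
    · refine fun h v => ⟨?_, ?_⟩
      · rintro hv ⟨h2, h1⟩
        exact h _ h1 (Or.inr (Or.inl ⟨v, hv, by ext <;> simp [h2]⟩))
      · rintro hv ⟨h2, h1⟩
        exact h _ hv (Or.inr (Or.inr ⟨_, h1, by ext <;> simp [h2]⟩))
    · rintro h x hx (hS | ⟨v, hv, hc⟩ | ⟨v, hv, hc⟩)
      · exact hA' x hx hS
      · exact (h v).1 hv (by simp [hc, hx])
      · exact (h x).2 hx (by simp [hc, hv])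

theorem callLaw_real_avoiding (P : SpreadingProtocol) (p : unitInterval) {n : ℕ} [NeZero n]
    {S A : Finset (Fin n)} (hA : Disjoint S A) (v : Fin n) :
    (callLaw n p).real (P.avoiding S A v) =
      (if v ∈ S then 1 - P.pushRate p * A.card / n else 1) *
        (if v ∈ A then 1 - P.pullRate p * S.card / n else 1) := by
  have hA' : v ∈ A → v ∉ S := fun hx hS => Finset.disjoint_left.mp hA hS hx
  by_cases hS : v ∈ S
  · have hvA : v ∉ A := fun h => hA' h hS
    cases P <;> simp [avoiding, hS, hvA, pushRate, -not_and, callLaw_real_no_success]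
  · by_cases hvA : v ∈ A
    · cases P <;> simp [avoiding, hS, hvA, pullRate, -not_and, callLaw_real_no_success]
    · simp [avoiding, hS, hvA]

/-- The probability that a set of uninformed nodes stays uninformed. -/
theorem roundLaw_real_avoiding (P : SpreadingProtocol) (p : unitInterval) {n : ℕ} [NeZero n]
    {S A : Finset (Fin n)} (hA : Disjoint S A) :
    (roundLaw n p).real {c | ∀ x ∈ A, x ∉ P.step S c} =
      (1 - P.pushRate p * A.card / n) ^ S.card * (1 - P.pullRate p * S.card / n) ^ A.card := by
  rw [P.avoiding_eq_pi hA, measureReal_def, roundLaw, Measure.pi_pi, ENNReal.toReal_prod]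
  simp only [← measureReal_def, P.callLaw_real_avoiding p hA]
  rw [Finset.prod_mul_distrib]
  simp [Finset.prod_ite_mem, Finset.prod_const]

theorem stayProb_eq (P : SpreadingProtocol) (p : unitInterval) {n : ℕ} [NeZero n]
    {S : Finset (Fin n)} {x : Fin n} (hx : x ∉ S) :
    P.stayProb p S x =
      (1 - P.pushRate p / n) ^ S.card * (1 - P.pullRate p * (S.card / n)) := by
  have := P.roundLaw_real_avoiding p (Finset.disjoint_singleton_right.mpr hx)
  simpa [stayProb, mul_div_assoc] using this

theorem roundLaw_real_pair (P : SpreadingProtocol) (p : unitInterval) {n : ℕ} [NeZero n]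
    {S : Finset (Fin n)} {x y : Fin n} (hx : x ∉ S) (hy : y ∉ S) (hxy : x ≠ y) :
    (roundLaw n p).real {c | x ∉ P.step S c ∧ y ∉ P.step S c} =
      (1 - P.pushRate p * 2 / n) ^ S.card * (1 - P.pullRate p * (S.card / n)) ^ 2 := by
  have := P.roundLaw_real_avoiding p (S := S) (A := {x, y}) (by simp [hx, hy])
  simpa [Finset.card_pair hxy, mul_div_assoc] using this

theorem pushRate_nonneg (P : SpreadingProtocol) (p : unitInterval) : 0 ≤ P.pushRate p := by
  cases P <;> simp [pushRate, p.2.1]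

theorem pushRate_le_one (P : SpreadingProtocol) (p : unitInterval) : P.pushRate p ≤ 1 := by
  cases P <;> simp [pushRate, p.2.2]

theorem pullRate_nonneg (P : SpreadingProtocol) (p : unitInterval) : 0 ≤ P.pullRate p := by
  cases P <;> simp [pullRate, p.2.1]

theorem pullRate_le_one (P : SpreadingProtocol) (p : unitInterval) : P.pullRate p ≤ 1 := by
  cases P <;> simp [pullRate, p.2.2]

/-- Two uninformed nodes stay uninformed in a negatively correlated way. -/
theorem roundLaw_real_pair_le (P : SpreadingProtocol) (p : unitInterval) {n : ℕ} [NeZero n]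
    {S : Finset (Fin n)} {x y : Fin n} (hx : x ∉ S) (hy : y ∉ S) (hxy : x ≠ y) :
    (roundLaw n p).real {c | x ∉ P.step S c ∧ y ∉ P.step S c} ≤
      P.stayProb p S x * P.stayProb p S y := by
  rw [P.roundLaw_real_pair p hx hy hxy, P.stayProb_eq p hx, P.stayProb_eq p hy]
  have hn : (2 : ℝ) ≤ n := by
    have := Fintype.one_lt_card_iff.mpr ⟨x, y, hxy⟩
    rw [Fintype.card_fin] at this
    exact_mod_cast this
  have h0 : 0 ≤ 1 - P.pushRate p * 2 / n := by
    rw [sub_nonneg, div_le_one (by linarith)]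
    nlinarith [P.pushRate_le_one p, P.pushRate_nonneg p]
  have h1 : 1 - P.pushRate p * 2 / n ≤ (1 - P.pushRate p / n) ^ 2 := by
    have := sq_nonneg (P.pushRate p / n)
    have h2 : P.pushRate p * 2 / n = 2 * (P.pushRate p / n) := by ring
    nlinarith
  calc _ ≤ ((1 - P.pushRate p / n) ^ 2) ^ S.card * (1 - P.pullRate p * (S.card / n)) ^ 2 := by
        gcongr
    _ = _ := by rw [← pow_mul]; ring

open Classical in
/-- The indicator of the event that `x` is uninformed after the round. -/
noncomputable def stayIndicator (P : SpreadingProtocol) {n : ℕ} (S : Finset (Fin n))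
    (x : Fin n) (c : Calls n) : ℝ :=
  if x ∉ P.step S c then 1 else 0

theorem integrable_roundLaw {n : ℕ} [NeZero n] (p : unitInterval) (f : Calls n → ℝ) :
    Integrable f (roundLaw n p) :=
  Integrable.of_finite

theorem integral_stayIndicator (P : SpreadingProtocol) (p : unitInterval) {n : ℕ} [NeZero n]
    (S : Finset (Fin n)) (x : Fin n) :
    ∫ c, P.stayIndicator S x c ∂(roundLaw n p) = P.stayProb p S x := by
  rw [stayProb, ← integral_indicator_one (Set.toFinite _).measurableSet]
  congr 1 with c
  simp [stayIndicator, Set.indicator_apply]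

theorem integral_stayIndicator_mul (P : SpreadingProtocol) (p : unitInterval) {n : ℕ} [NeZero n]
    (S : Finset (Fin n)) (x y : Fin n) :
    ∫ c, P.stayIndicator S x c * P.stayIndicator S y c ∂(roundLaw n p) =
      (roundLaw n p).real {c | x ∉ P.step S c ∧ y ∉ P.step S c} := by
  rw [← integral_indicator_one (Set.toFinite _).measurableSet]
  congr 1 with c
  by_cases h1 : x ∈ P.step S c <;> by_cases h2 : y ∈ P.step S c <;>
    simp [stayIndicator, h1, h2]

theorem roundCov_nonpos (P : SpreadingProtocol) (p : unitInterval) {n : ℕ} [NeZero n]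
    {S : Finset (Fin n)} {x y : Fin n} (hx : x ∉ S) (hy : y ∉ S) (hxy : x ≠ y) :
    P.roundCov p S x y ≤ 0 := by
  have h : ∀ z, P.informedIndicator S z = fun c => 1 - P.stayIndicator S z c := by
    intro z; ext c
    by_cases h1 : z ∈ P.step S c <;> simp [informedIndicator, stayIndicator, h1]
  rw [roundCov, h, h, covariance_const_sub_left (integrable_roundLaw p _),
    covariance_const_sub_right (integrable_roundLaw p _), neg_neg,
    covariance_eq_sub (MemLp.of_discrete) (MemLp.of_discrete),
    integral_stayIndicator, integral_stayIndicator]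
  have := P.roundLaw_real_pair_le p hx hy hxy
  rw [← integral_stayIndicator_mul] at this
  simp only [Pi.mul_apply]
  linarith

end SpreadingProtocol


/-- The probability that an uninformed node stays uninformed when `k` of `n` nodes are informed,
the push calls are successful with probability `a` and the pull calls with probability `b`. -/
noncomputable def stayRate (a b : ℝ) (n k : ℝ) (j : ℕ) : ℝ := (1 - a / n) ^ j * (1 - b * (k / n))

section StayRate

variable {a b n : ℝ} {j : ℕ}

theorem one_sub_div_pow_le (ha1 : a ≤ 1) (hn : 1 ≤ n) :
    (1 - a / n) ^ j ≤ Real.exp (-(a * (j / n))) := by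
  have h : 0 ≤ 1 - a / n := by
    rw [sub_nonneg, div_le_one (by linarith)]; linarith
  calc (1 - a / n) ^ j ≤ (Real.exp (-(a / n))) ^ j := by
        gcongr
        linarith [Real.add_one_le_exp (-(a / n))]
    _ = _ := by rw [← Real.exp_nat_mul]; congr 1; ring

theorem one_sub_le_one_sub_div_pow (ha1 : a ≤ 1) (hn : 1 ≤ n) :
    1 - a * (j / n) ≤ (1 - a / n) ^ j := by
  have h : a / n ≤ 1 := by rw [div_le_one (by linarith)]; linarith
  have := one_add_mul_le_pow (a := -(a / n)) (by linarith) j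
  calc 1 - a * (j / n) = 1 + j * -(a / n) := by ring
    _ ≤ _ := by rw [← sub_eq_add_neg] at this; exact this

theorem exp_neg_le_one_sub_div_pow (ha : 0 ≤ a) (ha1 : a ≤ 1) (hj : (j : ℝ) + 1 ≤ n) :
    Real.exp (-a) ≤ (1 - a / n) ^ j := by
  rcases Nat.eq_zero_or_pos j with rfl | hj0
  · simpa using ha
  have hj1 : (1 : ℝ) ≤ j := by exact_mod_cast hj0
  have hpos : 0 < 1 - a / n := by
    rw [sub_pos, div_lt_one (by linarith)]; linarith
  rw [← Real.le_log_iff_exp_le (by positivity), Real.log_pow]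
  have h := Real.one_sub_inv_le_log_of_pos hpos
  have h2 : 1 - (1 - a / n)⁻¹ = -(a / (n - a)) := by
    have : n - a ≠ 0 := by linarith
    have : n ≠ 0 := by linarith
    have : 1 - a / n ≠ 0 := hpos.ne'
    field_simp
    ring
  have h3 : j * (a / (n - a)) ≤ a := by
    rw [← mul_div_assoc, div_le_iff₀ (by linarith), mul_comm]
    exact mul_le_mul_of_nonneg_left (by linarith) ha
  nlinarith

theorem exp_neg_le_quadratic {x : ℝ} (hx : 0 ≤ x) : Real.exp (-x) ≤ 1 - x + x ^ 2 := by
  rw [Real.exp_neg, inv_le_iff_one_le_mul₀ (Real.exp_pos x)]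
  have := Real.add_one_le_exp x
  have h2 : 0 ≤ 1 - x + x ^ 2 := by nlinarith [sq_nonneg (x - 1)]
  nlinarith [mul_le_mul_of_nonneg_left this h2, pow_nonneg hx 3]

theorem exp_neg_le_one_sub_half {x : ℝ} (hx : 0 ≤ x) (hx1 : x ≤ 1) :
    Real.exp (-x) ≤ 1 - x / 2 := by
  rw [Real.exp_neg, inv_le_iff_one_le_mul₀ (Real.exp_pos x)]
  nlinarith [mul_le_mul_of_nonneg_left (Real.add_one_le_exp x) (by linarith : 0 ≤ 1 - x / 2)]

variable (ha : 0 ≤ a) (ha1 : a ≤ 1) (hb : 0 ≤ b) (hb1 : b ≤ 1) (hn : 1 ≤ n)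
  (hj : (j : ℝ) + 1 ≤ n)

theorem div_mem_unit (hn : 1 ≤ n) (hj : (j : ℝ) + 1 ≤ n) : 0 ≤ (j : ℝ) / n ∧ (j : ℝ) / n ≤ 1 :=
  ⟨by positivity, by rw [div_le_one (by linarith)]; linarith⟩

include ha ha1 hb hb1 hn hj

theorem one_sub_stayRate_le : 1 - stayRate a b n j j ≤ (a + b) * (j / n) := by
  obtain ⟨hx, hx1⟩ := div_mem_unit hn hj
  have h := one_sub_le_one_sub_div_pow (j := j) ha1 hn
  have hb2 : 0 ≤ 1 - b * (j / n) := by nlinarith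
  have := mul_le_mul_of_nonneg_right h hb2
  have h3 : 0 ≤ (a * (j / n)) * (b * (j / n)) := by positivity
  unfold stayRate
  nlinarith

theorem one_sub_stayRate_ge : (a + b) * (j / n) - 2 * (j / n) ^ 2 ≤ 1 - stayRate a b n j j := by
  obtain ⟨hx, hx1⟩ := div_mem_unit hn hj
  have h := (one_sub_div_pow_le (j := j) ha1 hn).trans
    (exp_neg_le_quadratic (x := a * (j / n)) (by positivity))
  have hb2 : 0 ≤ 1 - b * (j / n) := by nlinarith
  have := mul_le_mul_of_nonneg_right h hb2
  unfold stayRate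
  set x := (j : ℝ) / n
  have e1 : 0 ≤ (a * x) ^ 2 * (b * x) := by positivity
  have e2 : a ^ 2 * x ^ 2 ≤ 1 * x ^ 2 := by gcongr; nlinarith
  have e3 : a * b * x ^ 2 ≤ 1 * x ^ 2 := by gcongr; nlinarith
  nlinarith

theorem half_mul_le_one_sub_stayRate : (a + b) / 2 * (j / n) ≤ 1 - stayRate a b n j j := by
  obtain ⟨hx, hx1⟩ := div_mem_unit hn hj
  have h := (one_sub_div_pow_le (j := j) ha1 hn).trans
    (exp_neg_le_one_sub_half (x := a * (j / n)) (by positivity) (by nlinarith))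
  have hb2 : 0 ≤ 1 - b * (j / n) := by nlinarith
  have := mul_le_mul_of_nonneg_right h hb2
  unfold stayRate
  set x := (j : ℝ) / n
  have e3 : a * (b * x ^ 2) ≤ 1 * (b * x ^ 2) := by gcongr
  have e4 : b * x ^ 2 ≤ b * x := by gcongr; nlinarith
  nlinarith

theorem le_stayRate : Real.exp (-a) * (1 - b) ≤ stayRate a b n j j := by
  obtain ⟨hx, hx1⟩ := div_mem_unit hn hj
  have h := exp_neg_le_one_sub_div_pow (j := j) ha ha1 hj
  unfold stayRate
  have := (Real.exp_pos (-a)).le.trans h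
  have hbx : b * (j / n) ≤ b := mul_le_of_le_one_right hb hx1
  gcongr

theorem stayRate_le : stayRate a b n j j ≤ Real.exp (-a) * (1 - b) + 3 * ((n - j) / n) := by
  obtain ⟨hx, hx1⟩ := div_mem_unit hn hj
  have h := one_sub_div_pow_le (j := j) ha1 hn
  have hw : (n - j) / n = 1 - j / n := by rw [sub_div, div_self (by linarith)]
  rw [hw]
  unfold stayRate
  set x := (j : ℝ) / n
  set w := 1 - x with hwdef
  have hw0 : 0 ≤ w := by linarith
  have hw1 : w ≤ 1 := by linarith
  have e1 : Real.exp (-(a * x)) = Real.exp (-a) * Real.exp (a * w) := by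
    rw [← Real.exp_add]; congr 1; simp only [hwdef]; ring
  have haw : a * w ≤ 1 := by nlinarith
  have haw0 : 0 ≤ a * w := by positivity
  have e2 : Real.exp (a * w) ≤ 1 + 2 * (a * w) := by
    have := Real.abs_exp_sub_one_le (x := a * w) (by rw [abs_of_nonneg haw0]; exact haw)
    rw [abs_of_nonneg haw0] at this
    linarith [le_abs_self (Real.exp (a * w) - 1)]
  have hE1 : Real.exp (-a) ≤ 1 := Real.exp_le_one_iff.mpr (by linarith)
  have hE0 := Real.exp_pos (-a)
  have hb2 : 0 ≤ 1 - b * x := by nlinarith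
  have hbx : 1 - b * x = (1 - b) + b * w := by simp only [hwdef]; ring
  have e3 : (1 + 2 * (a * w)) * (1 - b * x) ≤ (1 - b) + 3 * w := by
    have : a * w ≤ w := by nlinarith
    have : b * w ≤ w := by nlinarith
    have : 2 * (a * w) * (1 - b * x) ≤ 2 * (a * w) * 1 := by
      gcongr
      nlinarith
    rw [hbx] at *
    nlinarith
  calc (1 - a / n) ^ j * (1 - b * x) ≤ Real.exp (-(a * x)) * (1 - b * x) := by gcongr
    _ ≤ Real.exp (-a) * (1 + 2 * (a * w)) * (1 - b * x) := by rw [e1]; gcongr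
    _ = Real.exp (-a) * ((1 + 2 * (a * w)) * (1 - b * x)) := by ring
    _ ≤ Real.exp (-a) * ((1 - b) + 3 * w) := by gcongr
    _ ≤ _ := by nlinarith

end StayRate

namespace SpreadingProtocol

theorem stayProb_eq_stayRate (P : SpreadingProtocol) (p : unitInterval) {n : ℕ} [NeZero n]
    {S : Finset (Fin n)} {x : Fin n} (hx : x ∉ S) :
    P.stayProb p S x = stayRate (P.pushRate p) (P.pullRate p) n S.card S.card :=
  P.stayProb_eq p hx

theorem card_add_one_le {n : ℕ} {S : Finset (Fin n)} {x : Fin n} (hx : x ∉ S) :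
    (S.card : ℝ) + 1 ≤ n := by
  have := Finset.card_lt_univ_of_notMem hx
  rw [Fintype.card_fin] at this
  exact_mod_cast this

theorem card_compl_cast {n : ℕ} (S : Finset (Fin n)) : (Sᶜ.card : ℝ) = n - S.card := by
  have := S.card_compl_add_card
  rw [Fintype.card_fin] at this
  have h : (Sᶜ.card : ℝ) + S.card = n := by exact_mod_cast this
  linarith

theorem neZero_of_mem {n : ℕ} (x : Fin n) : NeZero n := ⟨fun h => by subst h; exact x.elim0⟩

theorem one_le_cast (n : ℕ) [NeZero n] : (1 : ℝ) ≤ n := by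
  exact_mod_cast Nat.one_le_iff_ne_zero.mpr (NeZero.ne n)

theorem upperExpShrinking_of_rate (P : SpreadingProtocol) (p : unitInterval) {ρ : ℝ} (hρ : 0 < ρ)
    (h : Real.exp (-ρ) = Real.exp (-P.pushRate p) * (1 - P.pullRate p)) :
    P.UpperExpShrinking p ρ := by
  have h1 : Real.exp (-ρ) < 1 := Real.exp_lt_one_iff.mpr (by linarith)
  have h0 := Real.exp_pos (-ρ)
  refine ⟨hρ, (1 - Real.exp (-ρ)) / 6, 3, 0, by linarith, by linarith, by norm_num, le_rfl,
    by linarith, Eventually.of_forall fun n S _ _ => ⟨fun x hx => ?_, fun x hx y hy hxy => ?_⟩⟩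
  · have := neZero_of_mem x
    rw [P.stayProb_eq_stayRate p hx, h, card_compl_cast]
    exact stayRate_le (P.pushRate_nonneg p) (P.pushRate_le_one p) (P.pullRate_nonneg p)
      (P.pullRate_le_one p) (one_le_cast n) (card_add_one_le hx)
  · have := neZero_of_mem x
    simpa using P.roundCov_nonpos p hx hy hxy

theorem lowerExpShrinking_of_rate (P : SpreadingProtocol) (p : unitInterval) {ρ : ℝ} (hρ : 0 < ρ)
    (h : Real.exp (-ρ) = Real.exp (-P.pushRate p) * (1 - P.pullRate p)) :
    P.LowerExpShrinking p ρ := by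
  refine ⟨hρ, 1 / 2, 0, 0, by norm_num, by norm_num, le_rfl, le_rfl,
    Eventually.of_forall fun n S _ _ => ⟨fun x hx => ?_, fun x hx y hy hxy => ?_⟩⟩
  · have := neZero_of_mem x
    rw [P.stayProb_eq_stayRate p hx, h, zero_mul, sub_zero]
    exact le_stayRate (P.pushRate_nonneg p) (P.pushRate_le_one p) (P.pullRate_nonneg p)
      (P.pullRate_le_one p) (one_le_cast n) (card_add_one_le hx)
  · have := neZero_of_mem x
    simpa using P.roundCov_nonpos p hx hy hxy

theorem not_upperDoubleExpShrinking (P : SpreadingProtocol) (p : unitInterval)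
    (hb : P.pullRate p < 1) : ¬ P.UpperDoubleExpShrinking p := by
  rintro ⟨g, l, a, c, hg, -, hl, -, -, -, hev⟩
  have hlim : Tendsto (fun n : ℕ => a * ((1 : ℝ) / n) ^ (l - 1)) atTop (nhds 0) := by
    have h1 : Tendsto (fun n : ℕ => (1 : ℝ) / n) atTop (nhds 0) :=
      tendsto_one_div_atTop_nhds_zero_nat
    have h2 := (h1.rpow_const (Or.inr (by linarith : 0 ≤ l - 1))).const_mul a
    rwa [Real.zero_rpow (by linarith), mul_zero] at h2
  have hpos : 0 < Real.exp (-P.pushRate p) * (1 - P.pullRate p) :=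
    mul_pos (Real.exp_pos _) (by linarith)
  have hlarge : ∀ᶠ n : ℕ in atTop, 1 / g ≤ (n : ℝ) :=
    tendsto_natCast_atTop_atTop.eventually_ge_atTop _
  obtain ⟨n, hn, hsmall, hgn, hn2⟩ :=
    (hev.and ((hlim.eventually_lt_const hpos).and (hlarge.and (eventually_ge_atTop 2)))).exists
  have : NeZero n := ⟨by omega⟩
  let x : Fin n := ⟨0, by omega⟩
  have hx : x ∉ ({x}ᶜ : Finset (Fin n)) := by simp
  have hcard : ((({x}ᶜ : Finset (Fin n))ᶜ).card : ℝ) = 1 := by simp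
  have hne : ({x}ᶜ : Finset (Fin n)).Nonempty := ⟨⟨1, by omega⟩, by simp [x, Fin.ext_iff]⟩
  have h := (hn _ hne (by rw [hcard]; rwa [div_le_iff₀' hg] at hgn)).1 x hx
  rw [hcard, P.stayProb_eq_stayRate p hx] at h
  have := le_stayRate (P.pushRate_nonneg p) (P.pushRate_le_one p) (P.pullRate_nonneg p)
      (P.pullRate_le_one p) (one_le_cast n) (card_add_one_le hx)
  linarith

/-- The number of nodes that are uninformed after the round. -/
noncomputable def uninformedAfter (P : SpreadingProtocol) {n : ℕ} (S : Finset (Fin n))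
    (c : Calls n) : ℝ := ((P.step S c)ᶜ.card : ℝ)

theorem subset_step (P : SpreadingProtocol) {n : ℕ} (S : Finset (Fin n)) (c : Calls n) :
    S ⊆ P.step S c := by
  cases P <;> exact Finset.subset_union_left

theorem uninformedAfter_eq_sum (P : SpreadingProtocol) {n : ℕ} (S : Finset (Fin n))
    (c : Calls n) : P.uninformedAfter S c = ∑ x ∈ Sᶜ, P.stayIndicator S x c := by
  classical
  have h : (P.step S c)ᶜ = Sᶜ.filter (fun x => x ∉ P.step S c) := by
    ext x
    simp only [Finset.mem_compl, Finset.mem_filter]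
    exact ⟨fun h => ⟨fun hS => h (P.subset_step S c hS), h⟩, fun h => h.2⟩
  rw [uninformedAfter, h]
  simp [stayIndicator, Finset.sum_ite]

theorem uninformedAfter_nonneg (P : SpreadingProtocol) {n : ℕ} (S : Finset (Fin n))
    (c : Calls n) : 0 ≤ P.uninformedAfter S c := Nat.cast_nonneg _

theorem uninformedAfter_le (P : SpreadingProtocol) {n : ℕ} (S : Finset (Fin n))
    (c : Calls n) : P.uninformedAfter S c ≤ Sᶜ.card := by
  unfold uninformedAfter
  exact_mod_cast Finset.card_le_card (Finset.compl_subset_compl.mpr (P.subset_step S c))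

theorem integral_uninformedAfter (P : SpreadingProtocol) (p : unitInterval) {n : ℕ} [NeZero n]
    (S : Finset (Fin n)) :
    ∫ c, P.uninformedAfter S c ∂(roundLaw n p) =
      Sᶜ.card * stayRate (P.pushRate p) (P.pullRate p) n S.card S.card := by
  simp only [uninformedAfter_eq_sum]
  rw [integral_finsetSum _ (fun x _ => integrable_roundLaw p _)]
  rw [Finset.sum_congr rfl (fun x hx => by
    rw [integral_stayIndicator, P.stayProb_eq_stayRate p (Finset.mem_compl.mp hx)])]
  simp

/-- The number of uninformed nodes after a round has at most the variance of a binomial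
distribution. -/
theorem integral_uninformedAfter_sub_sq_le (P : SpreadingProtocol) (p : unitInterval) {n : ℕ}
    [NeZero n] (S : Finset (Fin n)) {q : ℝ}
    (hq : q = stayRate (P.pushRate p) (P.pullRate p) n S.card S.card) :
    ∫ c, (P.uninformedAfter S c - Sᶜ.card * q) ^ 2 ∂(roundLaw n p) ≤
      Sᶜ.card * (1 - q) * q := by
  have hmem : ∀ x ∈ Sᶜ, P.stayProb p S x = q := fun x hx => by
    rw [hq, P.stayProb_eq_stayRate p (Finset.mem_compl.mp hx)]
  have h2 : ∫ c, P.uninformedAfter S c ^ 2 ∂(roundLaw n p) ≤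
      Sᶜ.card * q + Sᶜ.card * (Sᶜ.card - 1) * q ^ 2 := by
    have e : ∀ c, P.uninformedAfter S c ^ 2 =
        ∑ x ∈ Sᶜ, ∑ y ∈ Sᶜ, P.stayIndicator S x c * P.stayIndicator S y c := fun c => by
      rw [uninformedAfter_eq_sum, sq, Finset.sum_mul_sum]
    simp only [e]
    rw [integral_finsetSum _ (fun x _ => integrable_roundLaw p _)]
    have hx : ∀ x ∈ Sᶜ, ∫ c, ∑ y ∈ Sᶜ, P.stayIndicator S x c * P.stayIndicator S y c
        ∂(roundLaw n p) ≤ q + (Sᶜ.card - 1) * q ^ 2 := fun x hx => by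
      rw [integral_finsetSum _ (fun y _ => integrable_roundLaw p _),
        ← Finset.add_sum_erase _ _ hx]
      refine add_le_add ?_ ?_
      · rw [integral_stayIndicator_mul, ← hmem x hx]
        simp [stayProb]
      · have hc : ((Sᶜ.card : ℝ) - 1) = ((Sᶜ.erase x).card : ℝ) := by
          rw [Finset.card_erase_of_mem hx, Nat.cast_sub (Finset.card_pos.mpr ⟨x, hx⟩)]
          simp
        rw [hc, ← nsmul_eq_mul]
        refine Finset.sum_le_card_nsmul _ _ _ fun y hy => ?_
        rw [integral_stayIndicator_mul]
        have hy' := Finset.mem_of_mem_erase hy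
        refine (P.roundLaw_real_pair_le p (Finset.mem_compl.mp hx) (Finset.mem_compl.mp hy')
          (Finset.ne_of_mem_erase hy).symm).trans ?_
        rw [hmem x hx, hmem y hy', sq]
    refine (Finset.sum_le_card_nsmul _ _ _ hx).trans ?_
    rw [nsmul_eq_mul]
    exact le_of_eq (by ring)
  have h1 := P.integral_uninformedAfter p S
  rw [← hq] at h1
  have e : ∀ c, (P.uninformedAfter S c - Sᶜ.card * q) ^ 2 =
      P.uninformedAfter S c ^ 2 - 2 * (Sᶜ.card * q) * P.uninformedAfter S c +
        (Sᶜ.card * q) ^ 2 := fun c => by ring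
  simp only [e]
  rw [integral_add (integrable_roundLaw p _) (integrable_roundLaw p _),
    integral_sub (integrable_roundLaw p _) (integrable_roundLaw p _), integral_const_mul, h1]
  simp
  nlinarith

end SpreadingProtocol


/-- On `[0, u]` the function `F` is bounded by a quadratic polynomial with a nonnegative leading
coefficient whose mean is `r` for each distribution with mean `z₀` and variance `v`. -/
def QuadBound (u z₀ v : ℝ) (F : ℝ → ℝ) (r : ℝ) : Prop :=
  ∃ α β : ℝ, 0 ≤ β ∧ ∀ z, 0 ≤ z → z ≤ u → F z ≤ r + α * (z - z₀) + β * ((z - z₀) ^ 2 - v)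

namespace QuadBound

variable {u z₀ v r r' : ℝ} {F G : ℝ → ℝ}

theorem add (hF : QuadBound u z₀ v F r) (hG : QuadBound u z₀ v G r') :
    QuadBound u z₀ v (fun z => F z + G z) (r + r') := by
  obtain ⟨α, β, hβ, h⟩ := hF
  obtain ⟨α', β', hβ', h'⟩ := hG
  refine ⟨α + α', β + β', add_nonneg hβ hβ', fun z hz hzu => ?_⟩
  have := add_le_add (h z hz hzu) (h' z hz hzu)
  dsimp only
  linarith

theorem const_mul {c : ℝ} (hc : 0 ≤ c) (hF : QuadBound u z₀ v F r) :
    QuadBound u z₀ v (fun z => c * F z) (c * r) := by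
  obtain ⟨α, β, hβ, h⟩ := hF
  refine ⟨c * α, c * β, mul_nonneg hc hβ, fun z hz hzu => ?_⟩
  have := mul_le_mul_of_nonneg_left (h z hz hzu) hc
  dsimp only
  linarith

theorem mono (hF : QuadBound u z₀ v F r) (h : r ≤ r') : QuadBound u z₀ v F r' := by
  obtain ⟨α, β, hβ, h'⟩ := hF
  exact ⟨α, β, hβ, fun z hz hzu => (h' z hz hzu).trans (by linarith)⟩

theorem congr (hF : QuadBound u z₀ v F r) (h : ∀ z, G z = F z) : QuadBound u z₀ v G r := by
  have : G = F := funext h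
  rwa [this]

theorem integral_le {Ω : Type*} [MeasurableSpace Ω] [Finite Ω] [MeasurableSingletonClass Ω]
    {μ : Measure Ω} [IsProbabilityMeasure μ] {W : Ω → ℝ}
    (hW0 : ∀ ω, 0 ≤ W ω) (hWu : ∀ ω, W ω ≤ u) (hmean : ∫ ω, W ω ∂μ = z₀)
    (hvar : ∫ ω, (W ω - z₀) ^ 2 ∂μ ≤ v) (hF : QuadBound u z₀ v F r) :
    ∫ ω, F (W ω) ∂μ ≤ r := by
  obtain ⟨α, β, hβ, h⟩ := hF
  have hint : ∀ f : Ω → ℝ, Integrable f μ := fun f => Integrable.of_finite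
  calc ∫ ω, F (W ω) ∂μ
      ≤ ∫ ω, (r + α * (W ω - z₀) + β * ((W ω - z₀) ^ 2 - v)) ∂μ :=
        integral_mono (hint _) (hint _) fun ω => h _ (hW0 ω) (hWu ω)
    _ = r + α * (∫ ω, W ω ∂μ - z₀) + β * (∫ ω, (W ω - z₀) ^ 2 ∂μ - v) := by
        rw [integral_add (hint _) (hint _), integral_add (hint _) (hint _), integral_const_mul,
          integral_const_mul, integral_sub (hint _) (hint _), integral_sub (hint _) (hint _)]
        simp
    _ ≤ r := by
        rw [hmean]
        nlinarith

theorem affine (c e : ℝ) : QuadBound u z₀ v (fun z => c * z + e) (c * z₀ + e) :=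
  ⟨c, 0, le_rfl, fun z _ _ => by dsimp only; linarith⟩

/-- Jensen's inequality for the logarithm. -/
theorem log_add_const {t : ℝ} (ht : 0 < t) (hz₀ : 0 ≤ z₀) :
    QuadBound u z₀ v (fun z => Real.log (z + t)) (Real.log (z₀ + t)) := by
  refine ⟨1 / (z₀ + t), 0, le_rfl, fun z hz _ => ?_⟩
  have h := Real.log_le_sub_one_of_pos (x := (z + t) / (z₀ + t)) (by positivity)
  rw [Real.log_div (by positivity) (by positivity)] at h
  have : (z + t) / (z₀ + t) - 1 = 1 / (z₀ + t) * (z - z₀) := by field_simp; ring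
  dsimp only
  linarith

theorem log_const_sub {n : ℝ} (hz₀ : z₀ < n) (hu : u < n) :
    QuadBound u z₀ v (fun z => Real.log (n - z)) (Real.log (n - z₀)) := by
  refine ⟨-(1 / (n - z₀)), 0, le_rfl, fun z _ hzu => ?_⟩
  have h1 : 0 < n - z₀ := by linarith
  have h2 : 0 < n - z := by linarith
  have h := Real.log_le_sub_one_of_pos (x := (n - z) / (n - z₀)) (by positivity)
  rw [Real.log_div (by positivity) (by positivity)] at h
  have : (n - z) / (n - z₀) - 1 = -(1 / (n - z₀)) * (z - z₀) := by field_simp; ring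
  dsimp only
  linarith

/-- A reverse Jensen inequality for the logarithm of a variable bounded from below. -/
theorem neg_log_const_sub {n : ℝ} (hz₀u : z₀ ≤ u) (hu : u < n) :
    QuadBound u z₀ v (fun z => -Real.log (n - z))
      (-Real.log (n - z₀) + v / (n - u) ^ 2) := by
  have hk : 0 < n - u := by linarith
  have h1 : 0 < n - z₀ := by linarith
  refine ⟨1 / (n - z₀), 1 / (n - u) ^ 2, by positivity, fun z _ hzu => ?_⟩
  have h2 : 0 < n - z := by linarith
  have h := Real.one_sub_inv_le_log_of_pos (x := (n - z) / (n - z₀)) (by positivity)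
  rw [Real.log_div (by positivity) (by positivity)] at h
  have e : 1 - ((n - z) / (n - z₀))⁻¹ =
      -(1 / (n - z₀) * (z - z₀)) - (z - z₀) ^ 2 / ((n - z) * (n - z₀)) := by
    field_simp; ring
  have e2 : (z - z₀) ^ 2 / ((n - z) * (n - z₀)) ≤ (z - z₀) ^ 2 / (n - u) ^ 2 := by
    gcongr
    rw [sq]
    gcongr
  have e3 : v / (n - u) ^ 2 + 1 / (n - u) ^ 2 * ((z - z₀) ^ 2 - v) =
      (z - z₀) ^ 2 / (n - u) ^ 2 := by ring
  dsimp only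
  linarith

theorem neg_inv_add_const {t : ℝ} (ht : 0 < t) (hz₀ : 0 ≤ z₀) :
    QuadBound u z₀ v (fun z => -(1 / (z + t))) (-(1 / (z₀ + t))) := by
  refine ⟨1 / (z₀ + t) ^ 2, 0, le_rfl, fun z hz _ => ?_⟩
  have h1 : 0 < z + t := by linarith
  have h2 : 0 < z₀ + t := by linarith
  have : -(1 / (z₀ + t)) + 1 / (z₀ + t) ^ 2 * (z - z₀) + 0 * ((z - z₀) ^ 2 - v) - -(1 / (z + t)) =
      (z - z₀) ^ 2 / ((z₀ + t) ^ 2 * (z + t)) := by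
    field_simp; ring
  have : 0 ≤ (z - z₀) ^ 2 / ((z₀ + t) ^ 2 * (z + t)) := by positivity
  dsimp only
  linarith

theorem inv_const_sub {n : ℝ} (hu : u < n) (hz₀u : z₀ ≤ u) (hv : v ≤ u - z₀) :
    QuadBound u z₀ v (fun z => 1 / (n - z))
      (1 / (n - u) - (u - z₀) / ((n - u) * (n - z₀ + 1))) := by
  set k := n - u with hkdef
  have hk : 0 < k := by simp only [hkdef]; linarith
  set d := u - z₀ with hd
  have hd0 : 0 ≤ d := by simp only [hd]; linarith
  have hM : n - z₀ + 1 = k + d + 1 := by simp only [hkdef, hd]; ring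
  rw [hM]
  set M := k + d + 1 with hMd
  have hM0 : 0 < M := by linarith
  refine ⟨(2 / M - (k + 2 * d) / M ^ 2) / k, 1 / (k * M ^ 2), by positivity,
    fun z _ hzu => ?_⟩
  have hx : 0 < n - z := by linarith
  have hxe : n - z = k + (d - (z - z₀)) := by simp only [hkdef, hd]; ring
  dsimp only
  rw [hxe] at hx ⊢
  set w := z - z₀ with hw
  have hDn : 0 ≤ d - w := by simp only [hd, hw]; linarith
  have h1 : 2 / M - (k + (d - w)) / M ^ 2 ≤ 1 / (k + (d - w)) := by
    have : 1 / (k + (d - w)) - (2 / M - (k + (d - w)) / M ^ 2) =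
        (M - (k + (d - w))) ^ 2 / (M ^ 2 * (k + (d - w))) := by
      field_simp; ring
    have : 0 ≤ (M - (k + (d - w))) ^ 2 / (M ^ 2 * (k + (d - w))) := by positivity
    linarith
  have h2 : 1 / (k + (d - w)) = 1 / k - (d - w) * (1 / (k + (d - w))) / k := by
    field_simp; ring
  have h3 : (d - w) * (2 / M - (k + (d - w)) / M ^ 2) / k ≤
      (d - w) * (1 / (k + (d - w))) / k := by gcongr
  have h4 : 1 / k - d / (k * M) + (2 / M - (k + 2 * d) / M ^ 2) / k * w +
      1 / (k * M ^ 2) * (w ^ 2 - v) =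
      1 / k - (d - w) * (2 / M - (k + (d - w)) / M ^ 2) / k + (d - v) / (k * M ^ 2) := by
    simp only [hMd] at hM0 ⊢
    field_simp
    ring
  have h5 : 0 ≤ (d - v) / (k * M ^ 2) := by
    have : 0 ≤ d - v := by linarith
    positivity
  linarith

theorem log_ge_quadratic {t : ℝ} (ht : 0 < t) :
    t - 1 - 2 * ((t - 1) ^ 2 / Real.sqrt t) ≤ Real.log t := by
  obtain ⟨s, hs, rfl⟩ : ∃ s : ℝ, 0 < s ∧ t = s ^ 2 :=
    ⟨Real.sqrt t, Real.sqrt_pos.mpr ht, (Real.sq_sqrt ht.le).symm⟩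
  rw [Real.sqrt_sq hs.le, Real.log_pow]
  have h := Real.one_sub_inv_le_log_of_pos hs
  have e : 2 * (1 - s⁻¹) - (s ^ 2 - 1 - 2 * ((s ^ 2 - 1) ^ 2 / s)) =
      (s - 1) ^ 2 * (2 * (s + 1) ^ 2 - (s + 2)) / s := by
    field_simp; ring
  have : 0 ≤ (s - 1) ^ 2 * (2 * (s + 1) ^ 2 - (s + 2)) / s := by
    have : 0 ≤ 2 * (s + 1) ^ 2 - (s + 2) := by nlinarith
    positivity
  push_cast
  linarith

/-- A reverse Jensen inequality for the logarithm. -/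
theorem neg_log_add_one (hz₀ : 0 ≤ z₀) :
    QuadBound u z₀ v (fun z => -Real.log (z + 1))
      (-Real.log (z₀ + 1) + 2 * v / ((z₀ + 1) * Real.sqrt (z₀ + 1))) := by
  have hx : 0 < z₀ + 1 := by linarith
  have hs : 0 < Real.sqrt (z₀ + 1) := Real.sqrt_pos.mpr hx
  refine ⟨-(1 / (z₀ + 1)), 2 / ((z₀ + 1) * Real.sqrt (z₀ + 1)), by positivity,
    fun z hz _ => ?_⟩
  have hz1 : 0 < z + 1 := by linarith
  have h := log_ge_quadratic (t := (z + 1) / (z₀ + 1)) (by positivity)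
  rw [Real.log_div (by positivity) (by positivity)] at h
  have e1 : (z + 1) / (z₀ + 1) - 1 = (z - z₀) / (z₀ + 1) := by field_simp; ring
  have e2 : 1 / Real.sqrt (z₀ + 1) ≤ Real.sqrt ((z + 1) / (z₀ + 1)) := by
    rw [Real.sqrt_div hz1.le]
    gcongr
    rw [Real.one_le_sqrt]
    linarith
  have e3 : ((z - z₀) / (z₀ + 1)) ^ 2 / Real.sqrt ((z + 1) / (z₀ + 1)) ≤
      ((z - z₀) / (z₀ + 1)) ^ 2 / (1 / Real.sqrt (z₀ + 1)) := by gcongr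
  have e4 : ((z - z₀) / (z₀ + 1)) ^ 2 / (1 / Real.sqrt (z₀ + 1)) =
      (z - z₀) ^ 2 / ((z₀ + 1) * Real.sqrt (z₀ + 1)) := by
    have : Real.sqrt (z₀ + 1) ^ 2 = z₀ + 1 := Real.sq_sqrt hx.le
    rw [div_pow, div_div_eq_mul_div, div_one, div_mul_eq_mul_div,
      div_eq_div_iff (by positivity) (by positivity)]
    linear_combination (z - z₀) ^ 2 * (z₀ + 1) * this
  rw [e1] at h
  have e5 : 2 * v / ((z₀ + 1) * Real.sqrt (z₀ + 1)) +
      2 / ((z₀ + 1) * Real.sqrt (z₀ + 1)) * ((z - z₀) ^ 2 - v) =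
      2 * ((z - z₀) ^ 2 / ((z₀ + 1) * Real.sqrt (z₀ + 1))) := by ring
  have e6 : -(1 / (z₀ + 1)) * (z - z₀) = -((z - z₀) / (z₀ + 1)) := by ring
  dsimp only
  rw [e6]
  linarith

theorem neg_inv_sqrt_add_one (hz₀ : 0 ≤ z₀) :
    QuadBound u z₀ v (fun z => -(1 / Real.sqrt (z + 1))) (-(1 / Real.sqrt (z₀ + 1))) := by
  obtain ⟨r, hr, hr2⟩ : ∃ r : ℝ, 0 < r ∧ z₀ + 1 = r ^ 2 :=
    ⟨Real.sqrt (z₀ + 1), Real.sqrt_pos.mpr (by linarith), (Real.sq_sqrt (by linarith)).symm⟩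
  refine ⟨1 / (2 * r ^ 3), 0, le_rfl, fun z hz _ => ?_⟩
  obtain ⟨s, hs, hs2⟩ : ∃ s : ℝ, 0 < s ∧ z + 1 = s ^ 2 :=
    ⟨Real.sqrt (z + 1), Real.sqrt_pos.mpr (by linarith), (Real.sq_sqrt (by linarith)).symm⟩
  have hz : z - z₀ = s ^ 2 - r ^ 2 := by linarith
  dsimp only
  rw [hs2, hr2, hz, Real.sqrt_sq hs.le, Real.sqrt_sq hr.le]
  have e : -(1 / r) + 1 / (2 * r ^ 3) * (s ^ 2 - r ^ 2) - -(1 / s) =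
      (s - r) ^ 2 * (s + 2 * r) / (2 * r ^ 3 * s) := by
    field_simp; ring
  have : 0 ≤ (s - r) ^ 2 * (s + 2 * r) / (2 * r ^ 3 * s) := by positivity
  linarith

end QuadBound


/-- Bounds on the probability `s` that an uninformed node becomes informed in a round that starts
with `k` informed and `u` uninformed nodes. -/
structure RoundBounds (γ ρ k u s : ℝ) : Prop where
  pos_rate : 0 < γ
  pos_shrink : 0 < ρ
  one_le_informed : 1 ≤ k
  one_le_uninformed : 1 ≤ u
  le_mul : s ≤ γ * (k / (k + u))
  ge_sub : γ * (k / (k + u)) - 2 * (k / (k + u)) ^ 2 ≤ s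
  ge_half : γ / 2 * (k / (k + u)) ≤ s
  exp_le : Real.exp (-ρ) ≤ 1 - s
  le_exp : 1 - s ≤ Real.exp (-ρ) + 3 * (u / (k + u))

theorem add_le_of_min_bounds {X Y K L x w : ℝ} (hx : 0 ≤ x) (hw : 0 ≤ w) (hxw : x + w = 1)
    (hK : 0 ≤ K) (hL : 0 ≤ L) (hX : X ≤ 0) (hX' : X ≤ -1 + K * x) (hY : Y ≤ 0)
    (hY' : Y ≤ -1 + L * w) : X + Y ≤ -1 + 2 * (K + L) * (x * w) := by
  have hKx := mul_nonneg hK hx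
  have hLw := mul_nonneg hL hw
  have hLx := mul_nonneg hL hx
  have hKw := mul_nonneg hK hw
  rcases le_total x w with h | h
  · nlinarith [mul_nonneg hKx (by linarith : 0 ≤ 2 * w - 1), mul_nonneg hLw hx]
  · nlinarith [mul_nonneg hLw (by linarith : 0 ≤ 2 * x - 1), mul_nonneg hKx hw]

namespace RoundBounds

variable {γ ρ k u s : ℝ} (h : RoundBounds γ ρ k u s)
include h

theorem frac_informed_pos : 0 < k / (k + u) := by
  have := h.one_le_informed
  have := h.one_le_uninformed
  positivity

theorem frac_uninformed_pos : 0 < u / (k + u) := by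
  have := h.one_le_informed
  have := h.one_le_uninformed
  positivity

theorem frac_add : k / (k + u) + u / (k + u) = 1 := by
  have := h.one_le_informed
  have := h.one_le_uninformed
  rw [← add_div, div_self (by linarith)]

theorem prob_pos : 0 < s :=
  lt_of_lt_of_le (mul_pos (half_pos h.pos_rate) h.frac_informed_pos) h.ge_half

theorem stay_pos : 0 < 1 - s := lt_of_lt_of_le (Real.exp_pos _) h.exp_le

theorem gain_div : u * s / k ≤ γ * (u / (k + u)) := by
  have := h.one_le_informed
  have := h.one_le_uninformed
  calc u * s / k ≤ u * (γ * (k / (k + u))) / k := by gcongr; exact h.le_mul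
    _ = _ := by field_simp

theorem gain_div_le : u * s / k ≤ γ := by
  have := h.gain_div
  nlinarith [h.frac_add, h.frac_informed_pos, h.pos_rate]

theorem log_growth_eq : Real.log (k + u * s) - Real.log k = Real.log (1 + u * s / k) := by
  have := h.one_le_informed
  have := h.one_le_uninformed
  have := h.prob_pos
  rw [← Real.log_div (by positivity) (by positivity)]
  congr 1
  field_simp

theorem log_growth_nonneg : 0 ≤ Real.log (k + u * s) - Real.log k := by
  have := h.one_le_informed
  have := h.one_le_uninformed
  have := h.prob_pos
  rw [h.log_growth_eq]
  exact Real.log_nonneg (by linarith [show 0 ≤ u * s / k by positivity])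

theorem log_growth_le : Real.log (k + u * s) - Real.log k ≤ Real.log (1 + γ) := by
  have := h.one_le_informed
  have := h.one_le_uninformed
  have := h.prob_pos
  rw [h.log_growth_eq]
  exact Real.log_le_log (by positivity) (by linarith [h.gain_div_le])

theorem log_growth_le_mul : Real.log (k + u * s) - Real.log k ≤ γ * (u / (k + u)) := by
  have := h.one_le_informed
  have := h.one_le_uninformed
  have := h.prob_pos
  rw [h.log_growth_eq]
  have := Real.log_le_sub_one_of_pos (x := 1 + u * s / k) (by positivity)
  linarith [h.gain_div]

theorem log_growth_ge :
    Real.log (1 + γ) - (γ + 2) * (k / (k + u)) ≤ Real.log (k + u * s) - Real.log k := by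
  have hk := h.one_le_informed
  have hu := h.one_le_uninformed
  have hs := h.prob_pos
  have hγ := h.pos_rate
  rw [h.log_growth_eq]
  have hpos : 0 ≤ u * s / k := by positivity
  have h1 := Real.log_le_sub_one_of_pos (x := (1 + γ) / (1 + u * s / k)) (by positivity)
  rw [Real.log_div (by positivity) (by positivity)] at h1
  have h2 : (1 + γ) / (1 + u * s / k) - 1 ≤ γ - u * s / k := by
    have e : (1 + γ) / (1 + u * s / k) - 1 = (γ - u * s / k) / (1 + u * s / k) := by
      have : 1 + u * s / k ≠ 0 := by positivity
      rw [div_sub_one this]; congr 1; ring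
    rw [e]
    exact div_le_self (by linarith [h.gain_div_le]) (by linarith)
  have h3 : (u / (k + u)) * (γ - 2 * (k / (k + u))) ≤ u * s / k := by
    calc (u / (k + u)) * (γ - 2 * (k / (k + u)))
        = u * (γ * (k / (k + u)) - 2 * (k / (k + u)) ^ 2) / k := by field_simp
      _ ≤ u * s / k := by gcongr; exact h.ge_sub
  have hx := h.frac_informed_pos
  have hw : u / (k + u) = 1 - k / (k + u) := by linarith [h.frac_add]
  rw [hw] at h3
  nlinarith [sq_nonneg (k / (k + u))]

theorem shrink_eq : Real.log (u * (1 - s) + 1) - Real.log (u + 1) =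
    Real.log (1 - s + s / (u + 1)) := by
  have hu := h.one_le_uninformed
  have hs := h.stay_pos
  rw [← Real.log_div (by positivity) (by positivity)]
  congr 1
  field_simp
  ring

theorem log_shrink_nonpos : Real.log (u * (1 - s) + 1) - Real.log (u + 1) ≤ 0 := by
  have hu := h.one_le_uninformed
  have hs := h.stay_pos
  have hp := h.prob_pos
  rw [sub_nonpos]
  exact Real.log_le_log (by positivity) (by nlinarith)

theorem log_shrink_le : Real.log (u * (1 - s) + 1) - Real.log (u + 1) ≤
    -ρ + 3 * Real.exp ρ * (u / (k + u)) + Real.exp ρ * (s / (u + 1)) := by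
  have hu := h.one_le_uninformed
  have hs := h.stay_pos
  have hp := h.prob_pos
  rw [h.shrink_eq]
  have hpos : 0 < 1 - s + s / (u + 1) := by positivity
  have h1 := Real.log_le_sub_one_of_pos (mul_pos hpos (Real.exp_pos ρ))
  rw [Real.log_mul hpos.ne' (Real.exp_pos ρ).ne', Real.log_exp] at h1
  have h2 : Real.exp (-ρ) * Real.exp ρ = 1 := by rw [← Real.exp_add]; simp
  have h3 := mul_le_mul_of_nonneg_right h.le_exp (Real.exp_pos ρ).le
  linarith

theorem log_shrink_ge : -ρ ≤ Real.log (u * (1 - s) + 1) - Real.log (u + 1) := by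
  have hu := h.one_le_uninformed
  have hp := h.prob_pos
  rw [h.shrink_eq, Real.le_log_iff_exp_le (by have := h.stay_pos; positivity)]
  linarith [h.exp_le, show 0 ≤ s / (u + 1) by positivity]

theorem log_shrink_ge_mul : -(Real.exp ρ * γ * (k / (k + u))) ≤
    Real.log (u * (1 - s) + 1) - Real.log (u + 1) := by
  have hu := h.one_le_uninformed
  have hs := h.stay_pos
  have hp := h.prob_pos
  rw [h.shrink_eq]
  have h1 : Real.log (1 - s) ≤ Real.log (1 - s + s / (u + 1)) :=
    Real.log_le_log hs (by linarith [show 0 ≤ s / (u + 1) by positivity])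
  have h2 := Real.one_sub_inv_le_log_of_pos hs
  have h3 : 1 - (1 - s)⁻¹ = -(s * (1 - s)⁻¹) := by field_simp; ring
  have h4 : (1 - s)⁻¹ ≤ Real.exp ρ := by
    rw [← neg_neg ρ, Real.exp_neg (-ρ)]
    exact inv_anti₀ (Real.exp_pos _) h.exp_le
  have h5 : s * (1 - s)⁻¹ ≤ (γ * (k / (k + u))) * Real.exp ρ :=
    mul_le_mul h.le_mul h4 (by positivity) (hp.le.trans h.le_mul)
  linarith

theorem half_mul_le_gain : γ / 2 * (k / (k + u) * (u / (k + u))) ≤ u * s / (k + u) := by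
  have hw := h.frac_uninformed_pos
  have := mul_le_mul_of_nonneg_right h.ge_half hw.le
  calc _ = γ / 2 * (k / (k + u)) * (u / (k + u)) := by ring
    _ ≤ s * (u / (k + u)) := this
    _ = _ := by ring

theorem inv_gain : u * s / k ^ 2 ≤ (2 + γ) * (u * s / (k * (k + u * s + 1))) := by
  have hk := h.one_le_informed
  have hu := h.one_le_uninformed
  have hp := h.prob_pos
  have hγ := h.pos_rate
  have h1 : u * s ≤ γ * k := by
    have := h.gain_div_le
    rwa [div_le_iff₀ (by linarith)] at this
  have h2 : k + u * s + 1 ≤ (2 + γ) * k := by linarith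
  rw [← mul_div_assoc, div_le_div_iff₀ (by positivity) (by positivity)]
  nlinarith [mul_le_mul_of_nonneg_left h2 (by positivity : 0 ≤ u * s * k)]

theorem inv_shrink : s / (u + 1) ≤ 2 * (1 / (u * (1 - s) + 1) - 1 / (u + 1)) := by
  have hu := h.one_le_uninformed
  have hp := h.prob_pos
  have hs := h.stay_pos
  have e : 2 * (1 / (u * (1 - s) + 1) - 1 / (u + 1)) =
      2 * (u * s) / ((u * (1 - s) + 1) * (u + 1)) := by field_simp; ring
  rw [e, div_le_div_iff₀ (by positivity) (by positivity)]
  have h1 : u * (1 - s) + 1 ≤ 2 * u := by nlinarith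
  nlinarith [mul_le_mul_of_nonneg_left h1 (by positivity : 0 ≤ s * (u + 1))]

theorem inv_sqrt_shrink : s / Real.sqrt (u + 1) ≤
    4 * (1 / Real.sqrt (u * (1 - s) + 1) - 1 / Real.sqrt (u + 1)) := by
  have hu := h.one_le_uninformed
  have hp := h.prob_pos
  have hs := h.stay_pos
  have hr2 := Real.sq_sqrt (show 0 ≤ u * (1 - s) + 1 by positivity)
  have ht2 := Real.sq_sqrt (show 0 ≤ u + 1 by positivity)
  have hr : 0 < Real.sqrt (u * (1 - s) + 1) := Real.sqrt_pos.mpr (by positivity)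
  have ht : 0 < Real.sqrt (u + 1) := Real.sqrt_pos.mpr (by positivity)
  have hrt : Real.sqrt (u * (1 - s) + 1) ≤ Real.sqrt (u + 1) :=
    Real.sqrt_le_sqrt (by nlinarith)
  set r := Real.sqrt (u * (1 - s) + 1)
  set t := Real.sqrt (u + 1)
  have e : 4 * (1 / r - 1 / t) - s / t = (4 * (t - r) - s * r) / (r * t) := by field_simp
  have h1 : (t - r) * (t + r) = u * s := by nlinarith
  have h2 : 0 ≤ 4 * (t - r) - s * r := by
    have h3 : s * r * (t + r) ≤ 4 * (t - r) * (t + r) := by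
      have : r * (t + r) ≤ 2 * t ^ 2 := by nlinarith
      have := mul_le_mul_of_nonneg_left this hp.le
      nlinarith
    linarith [le_of_mul_le_mul_right h3 (by linarith)]
  have h4 : 0 ≤ (4 * (t - r) - s * r) / (r * t) := by positivity
  linarith

theorem sqrt_error : 2 * (u * s * (1 - s)) /
      ((u * (1 - s) + 1) * Real.sqrt (u * (1 - s) + 1)) ≤
    2 * Real.exp ρ * (s / Real.sqrt (u + 1)) := by
  have hu := h.one_le_uninformed
  have hp := h.prob_pos
  have hs := h.stay_pos
  have hr : 0 < Real.sqrt (u * (1 - s) + 1) := Real.sqrt_pos.mpr (by positivity)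
  have ht : 0 < Real.sqrt (u + 1) := Real.sqrt_pos.mpr (by positivity)
  have hE := Real.exp_pos ρ
  have hE1 : 1 ≤ Real.exp ρ := Real.one_le_exp h.pos_shrink.le
  have h2 : 1 ≤ Real.exp ρ * (1 - s) := by
    have := mul_le_mul_of_nonneg_left h.exp_le hE.le
    rwa [← Real.exp_add, add_neg_cancel, Real.exp_zero] at this
  have h1 : Real.sqrt (u + 1) ≤ Real.exp ρ * Real.sqrt (u * (1 - s) + 1) := by
    rw [Real.sqrt_le_left (by positivity), mul_pow, Real.sq_sqrt (by positivity)]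
    have : u + 1 ≤ Real.exp ρ * (u * (1 - s) + 1) := by nlinarith
    nlinarith
  calc _ ≤ 2 * (s * (u * (1 - s) + 1)) /
        ((u * (1 - s) + 1) * Real.sqrt (u * (1 - s) + 1)) := by
        refine div_le_div_of_nonneg_right ?_ (by positivity)
        linarith
    _ = 2 * s * (1 / Real.sqrt (u * (1 - s) + 1)) := by field_simp
    _ ≤ 2 * s * (Real.exp ρ / Real.sqrt (u + 1)) := by
        gcongr ?_ * ?_
        rw [div_le_div_iff₀ hr ht, one_mul]
        exact h1
    _ = _ := by ring

end RoundBounds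

section Potential

variable (γ ρ : ℝ)

/-- The coefficient of the logarithm of the number of informed nodes. -/
noncomputable def growthCoeff : ℝ := 1 / Real.log (1 + γ)

/-- The coefficient of the linear correction in the potentials. -/
noncomputable def linearCoeff : ℝ :=
  4 / γ * (growthCoeff γ * (γ + 2) + 1 / ρ * (3 * Real.exp ρ) +
    (growthCoeff γ * γ + 1 / ρ * (Real.exp ρ * γ)))

/-- A potential that decreases by at least one in a round, in expectation, as a function of the
number `z` of uninformed nodes. -/
noncomputable def upperPotential (n z : ℝ) : ℝ :=
  growthCoeff γ * -Real.log (n - z) + 1 / ρ * Real.log (z + 1) +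
    growthCoeff γ * (2 + γ) * (1 / (n - z)) + 2 * (1 / ρ * Real.exp ρ) * -(1 / (z + 1)) +
    (linearCoeff γ ρ / n * z + growthCoeff γ * Real.log n)

/-- A potential that decreases by at most one in a round, in expectation, as a function of the
number `z` of uninformed nodes. -/
noncomputable def lowerPotential (n z : ℝ) : ℝ :=
  growthCoeff γ * -Real.log (n - z) + 1 / ρ * Real.log (z + 1) +
    8 * (1 / ρ * Real.exp ρ) * (1 / Real.sqrt (z + 1)) +
    (-(linearCoeff γ ρ / n) * z + growthCoeff γ * Real.log n)

variable {γ ρ}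

theorem growthCoeff_pos (hγ : 0 < γ) : 0 < growthCoeff γ :=
  one_div_pos.mpr (Real.log_pos (by linarith))

theorem linearCoeff_pos (hγ : 0 < γ) (hρ : 0 < ρ) : 0 < linearCoeff γ ρ := by
  have := growthCoeff_pos hγ
  have := Real.exp_pos ρ
  unfold linearCoeff
  positivity

variable {k u s n : ℝ}

theorem quadBound_upperPotential (h : RoundBounds γ ρ k u s) (hn : n = k + u) :
    QuadBound u (u * (1 - s)) (u * s * (1 - s)) (upperPotential γ ρ n)
      (upperPotential γ ρ n u - 1) := by
  have hk := h.one_le_informed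
  have hu := h.one_le_uninformed
  have hp := h.prob_pos
  have hs := h.stay_pos
  have hA := growthCoeff_pos h.pos_rate
  have hγ := h.pos_rate
  have hρ := h.pos_shrink
  have hE := Real.exp_pos ρ
  have hz₀ : 0 ≤ u * (1 - s) := by positivity
  have hz₀u : u * (1 - s) ≤ u := by nlinarith
  have hun : u < n := by linarith
  have hv : u * s * (1 - s) ≤ u - u * (1 - s) := by
    nlinarith [mul_pos (by linarith : 0 < u) (mul_pos hp hp)]
  have hnk : n - u = k := by linarith
  have hnm : n - u * (1 - s) = k + u * s := by rw [hn]; ring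
  have hd : u - u * (1 - s) = u * s := by ring
  refine QuadBound.mono (((((QuadBound.neg_log_const_sub hz₀u hun).const_mul hA.le).add
    ((QuadBound.log_add_const one_pos hz₀).const_mul (c := 1 / ρ) (by positivity))).add
    ((QuadBound.inv_const_sub hun hz₀u hv).const_mul
      (c := growthCoeff γ * (2 + γ)) (by positivity))).add
    ((QuadBound.neg_inv_add_const one_pos hz₀).const_mul
      (c := 2 * (1 / ρ * Real.exp ρ)) (by positivity)) |>.add
    (QuadBound.affine (linearCoeff γ ρ / n) (growthCoeff γ * Real.log n))) ?_
  unfold upperPotential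
  rw [hnk, hnm, hd]
  set A := growthCoeff γ
  have hAlog : A * Real.log (1 + γ) = 1 :=
    one_div_mul_cancel (Real.log_pos (by linarith)).ne'
  have hBρ : 1 / ρ * ρ = 1 := one_div_mul_cancel hρ.ne'
  have hB : 0 < 1 / ρ := by positivity
  set B := 1 / ρ
  -- the error of Jensen's inequality in the growth term
  have h1 : A * (u * s * (1 - s) / k ^ 2) ≤
      A * (2 + γ) * (u * s / (k * (k + u * s + 1))) := by
    have h0 : u * s * (1 - s) / k ^ 2 ≤ u * s / k ^ 2 := by
      refine div_le_div_of_nonneg_right ?_ (by positivity)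
      nlinarith [mul_pos (by linarith : 0 < u) (mul_pos hp hp)]
    linarith [mul_le_mul_of_nonneg_left (h0.trans h.inv_gain) hA.le]
  have h2 : B * Real.exp ρ * (s / (u + 1)) ≤
      B * Real.exp ρ * (2 * (1 / (u * (1 - s) + 1) - 1 / (u + 1))) := by
    gcongr
    exact h.inv_shrink
  have hBs : 0 ≤ B * Real.exp ρ * (s / (u + 1)) := by positivity
  have hX : -(A * (Real.log (k + u * s) - Real.log k)) ≤ 0 := by
    have := h.log_growth_nonneg
    nlinarith
  have hX' : -(A * (Real.log (k + u * s) - Real.log k)) ≤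
      -1 + (A * (γ + 2)) * (k / (k + u)) := by
    have := mul_le_mul_of_nonneg_left h.log_growth_ge hA.le
    linarith
  have hY : B * (Real.log (u * (1 - s) + 1) - Real.log (u + 1)) -
      B * Real.exp ρ * (s / (u + 1)) ≤ 0 := by
    have := mul_nonneg_of_nonpos_of_nonpos (neg_nonpos.mpr hB.le) h.log_shrink_nonpos
    linarith
  have hY' : B * (Real.log (u * (1 - s) + 1) - Real.log (u + 1)) -
      B * Real.exp ρ * (s / (u + 1)) ≤ -1 + (B * (3 * Real.exp ρ)) * (u / (k + u)) := by
    have := mul_le_mul_of_nonneg_left h.log_shrink_le hB.le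
    linarith
  have hsum := add_le_of_min_bounds h.frac_informed_pos.le h.frac_uninformed_pos.le h.frac_add
    (by positivity) (by positivity) hX hX' hY hY'
  have hlin : 2 * (A * (γ + 2) + B * (3 * Real.exp ρ)) * (k / (k + u) * (u / (k + u))) ≤
      linearCoeff γ ρ / n * u - linearCoeff γ ρ / n * (u * (1 - s)) := by
    have e : linearCoeff γ ρ / n * u - linearCoeff γ ρ / n * (u * (1 - s)) =
        linearCoeff γ ρ * (u * s / (k + u)) := by rw [hn]; ring
    rw [e]
    calc _ = (4 / γ * (A * (γ + 2) + B * (3 * Real.exp ρ))) *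
          (γ / 2 * (k / (k + u) * (u / (k + u)))) := by field_simp; ring
      _ ≤ linearCoeff γ ρ * (u * s / (k + u)) := by
          refine mul_le_mul ?_ h.half_mul_le_gain ?_ (linearCoeff_pos hγ hρ).le
          · unfold linearCoeff
            refine mul_le_mul_of_nonneg_left ?_ (by positivity)
            refine le_add_of_nonneg_right ?_
            positivity
          · positivity
  linarith

theorem quadBound_neg_lowerPotential (h : RoundBounds γ ρ k u s) (hn : n = k + u) :
    QuadBound u (u * (1 - s)) (u * s * (1 - s)) (fun z => -lowerPotential γ ρ n z)
      (-lowerPotential γ ρ n u + 1) := by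
  have hk := h.one_le_informed
  have hu := h.one_le_uninformed
  have hp := h.prob_pos
  have hs := h.stay_pos
  have hA := growthCoeff_pos h.pos_rate
  have hγ := h.pos_rate
  have hρ := h.pos_shrink
  have hE := Real.exp_pos ρ
  have hz₀ : 0 ≤ u * (1 - s) := by positivity
  have hz₀u : u * (1 - s) ≤ u := by nlinarith
  have hun : u < n := by linarith
  have hnk : n - u = k := by linarith
  have hnm : n - u * (1 - s) = k + u * s := by rw [hn]; ring
  refine QuadBound.mono (QuadBound.congr
    (((((QuadBound.log_const_sub (hz₀u.trans_lt hun) hun).const_mul hA.le).add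
    ((QuadBound.neg_log_add_one hz₀).const_mul (c := 1 / ρ) (by positivity))).add
    ((QuadBound.neg_inv_sqrt_add_one hz₀).const_mul
      (c := 8 * (1 / ρ * Real.exp ρ)) (by positivity))).add
    (QuadBound.affine (linearCoeff γ ρ / n) (-(growthCoeff γ * Real.log n))))
    (fun z => by unfold lowerPotential; ring)) ?_
  unfold lowerPotential
  rw [hnk, hnm]
  set A := growthCoeff γ
  have hAlog : A * Real.log (1 + γ) = 1 :=
    one_div_mul_cancel (Real.log_pos (by linarith)).ne'
  have hBρ : 1 / ρ * ρ = 1 := one_div_mul_cancel hρ.ne'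
  have hB : 0 < 1 / ρ := by positivity
  set B := 1 / ρ
  have h2 : B * Real.exp ρ * (s / Real.sqrt (u + 1)) ≤
      B * Real.exp ρ *
        (4 * (1 / Real.sqrt (u * (1 - s) + 1) - 1 / Real.sqrt (u + 1))) := by
    gcongr
    exact h.inv_sqrt_shrink
  have h3 := mul_le_mul_of_nonneg_left h.sqrt_error hB.le
  have hX : A * (Real.log (k + u * s) - Real.log k) - 1 ≤ 0 := by
    have := mul_le_mul_of_nonneg_left h.log_growth_le hA.le
    linarith
  have hX' : A * (Real.log (k + u * s) - Real.log k) - 1 ≤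
      -1 + (A * γ) * (u / (k + u)) := by
    have := mul_le_mul_of_nonneg_left h.log_growth_le_mul hA.le
    linarith
  have hY : -(B * (Real.log (u * (1 - s) + 1) - Real.log (u + 1))) - 1 ≤ 0 := by
    have := mul_le_mul_of_nonneg_left h.log_shrink_ge hB.le
    linarith
  have hY' : -(B * (Real.log (u * (1 - s) + 1) - Real.log (u + 1))) - 1 ≤
      -1 + (B * (Real.exp ρ * γ)) * (k / (k + u)) := by
    have := mul_le_mul_of_nonneg_left h.log_shrink_ge_mul hB.le
    linarith
  have hsum := add_le_of_min_bounds h.frac_uninformed_pos.le h.frac_informed_pos.le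
    ((add_comm _ _).trans h.frac_add) (by positivity) (by positivity) hX hX' hY hY'
  have hlin : 2 * (A * γ + B * (Real.exp ρ * γ)) * (u / (k + u) * (k / (k + u))) ≤
      linearCoeff γ ρ / n * u - linearCoeff γ ρ / n * (u * (1 - s)) := by
    have e : linearCoeff γ ρ / n * u - linearCoeff γ ρ / n * (u * (1 - s)) =
        linearCoeff γ ρ * (u * s / (k + u)) := by rw [hn]; ring
    rw [e]
    calc _ = (4 / γ * (A * γ + B * (Real.exp ρ * γ))) *
          (γ / 2 * (k / (k + u) * (u / (k + u)))) := by field_simp; ring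
      _ ≤ linearCoeff γ ρ * (u * s / (k + u)) := by
          refine mul_le_mul ?_ h.half_mul_le_gain ?_ (linearCoeff_pos hγ hρ).le
          · unfold linearCoeff
            refine mul_le_mul_of_nonneg_left ?_ (by positivity)
            refine le_add_of_nonneg_left ?_
            positivity
          · positivity
  linarith

theorem upperPotential_ge (hγ : 0 < γ) (hρ : 0 < ρ) {z : ℝ} (hz : 0 ≤ z) (hzn : z + 1 ≤ n) :
    -(2 * (1 / ρ * Real.exp ρ)) ≤ upperPotential γ ρ n z := by
  have hA := growthCoeff_pos hγ
  have hL := linearCoeff_pos hγ hρ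
  have hE := Real.exp_pos ρ
  have hnz : 0 < n - z := by linarith
  have hn0 : 0 < n := by linarith
  have h1 : Real.log (n - z) ≤ Real.log n := Real.log_le_log hnz (by linarith)
  have h1' := mul_le_mul_of_nonneg_left h1 hA.le
  have h2 : 0 ≤ 1 / ρ * Real.log (z + 1) :=
    mul_nonneg (by positivity) (Real.log_nonneg (by linarith))
  have h3 : 0 ≤ growthCoeff γ * (2 + γ) * (1 / (n - z)) := by positivity
  have h4 : 2 * (1 / ρ * Real.exp ρ) * (1 / (z + 1)) ≤ 2 * (1 / ρ * Real.exp ρ) :=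
    mul_le_of_le_one_right (by positivity) (by rw [div_le_one (by linarith)]; linarith)
  have h5 : 0 ≤ linearCoeff γ ρ / n * z := by positivity
  unfold upperPotential
  linarith

theorem upperPotential_start_le (hγ : 0 < γ) (hρ : 0 < ρ) (hn : 1 ≤ n) :
    upperPotential γ ρ n (n - 1) ≤ growthCoeff γ * Real.log n + 1 / ρ * Real.log n +
      (growthCoeff γ * (2 + γ) + linearCoeff γ ρ) := by
  have hL := linearCoeff_pos hγ hρ
  have hE := Real.exp_pos ρ
  unfold upperPotential
  rw [sub_sub_cancel, sub_add_cancel, Real.log_one]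
  have h4 : 0 ≤ 2 * (1 / ρ * Real.exp ρ) * (1 / n) := by positivity
  have h5 : linearCoeff γ ρ / n * (n - 1) ≤ linearCoeff γ ρ := by
    have e : linearCoeff γ ρ / n * (n - 1) = linearCoeff γ ρ - linearCoeff γ ρ / n := by
      field_simp
    have : 0 ≤ linearCoeff γ ρ / n := by positivity
    linarith
  linarith

theorem lowerPotential_zero (γ ρ n : ℝ) :
    lowerPotential γ ρ n 0 = 8 * (1 / ρ * Real.exp ρ) := by
  simp [lowerPotential]

theorem lowerPotential_start_ge (hγ : 0 < γ) (hρ : 0 < ρ) (hn : 1 ≤ n) :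
    growthCoeff γ * Real.log n + 1 / ρ * Real.log n - linearCoeff γ ρ ≤
      lowerPotential γ ρ n (n - 1) := by
  have hL := linearCoeff_pos hγ hρ
  have hE := Real.exp_pos ρ
  unfold lowerPotential
  rw [sub_sub_cancel, sub_add_cancel, Real.log_one]
  have h4 : 0 ≤ 8 * (1 / ρ * Real.exp ρ) * (1 / Real.sqrt n) := by positivity
  have h5 : linearCoeff γ ρ / n * (n - 1) ≤ linearCoeff γ ρ := by
    have e : linearCoeff γ ρ / n * (n - 1) = linearCoeff γ ρ - linearCoeff γ ρ / n := by
      field_simp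
    have : 0 ≤ linearCoeff γ ρ / n := by positivity
    linarith
  linarith

end Potential


namespace SpreadingProtocol

variable {n : ℕ} (P : SpreadingProtocol) (p : unitInterval)

theorem informed_succ (v₀ : Fin n) (ω : ℕ → Calls n) (t : ℕ) :
    P.informed v₀ ω (t + 1) = P.step (P.informed v₀ ω t) (ω t) := rfl

theorem informed_congr (v₀ : Fin n) {ω ω' : ℕ → Calls n} {t : ℕ} (h : ∀ i < t, ω i = ω' i) :
    P.informed v₀ ω t = P.informed v₀ ω' t := by
  induction t with
  | zero => rfl
  | succ t ih =>
    rw [informed_succ, informed_succ, ih fun i hi => h i (by omega), h t (by omega)]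

theorem informed_mono (v₀ : Fin n) (ω : ℕ → Calls n) : Monotone (P.informed v₀ ω) :=
  monotone_nat_of_le_succ fun _ => P.subset_step _ _

theorem informed_nonempty (v₀ : Fin n) (ω : ℕ → Calls n) (t : ℕ) :
    (P.informed v₀ ω t).Nonempty :=
  ⟨v₀, P.informed_mono v₀ ω (Nat.zero_le t) (Finset.mem_singleton_self v₀)⟩

theorem step_univ (c : Calls n) : P.step Finset.univ c = Finset.univ :=
  Finset.univ_subset_iff.mp (P.subset_step _ c)

/-- The informed nodes after `t` rounds as a function of the calls of the first `t` rounds. -/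
noncomputable def informedOfHistory (v₀ : Fin n) (t : ℕ) (h : Finset.range t → Calls n) :
    Finset (Fin n) :=
  P.informed v₀ (fun i => if hi : i ∈ Finset.range t then h ⟨i, hi⟩ else fun _ => (v₀, false)) t

theorem informed_eq_informedOfHistory (v₀ : Fin n) (ω : ℕ → Calls n) (t : ℕ) :
    P.informed v₀ ω t = P.informedOfHistory v₀ t (fun i => ω i) :=
  P.informed_congr v₀ fun i hi => by simp [hi]

theorem measurable_history (t : ℕ) :
    Measurable (fun (ω : ℕ → Calls n) (i : Finset.range t) => ω i) := by fun_prop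

theorem measurable_comp_informed (v₀ : Fin n) (t : ℕ) {α : Type*} [MeasurableSpace α]
    (f : Finset (Fin n) → α) : Measurable (fun ω => f (P.informed v₀ ω t)) := by
  simp only [informed_eq_informedOfHistory]
  exact (measurable_of_finite (fun h => f (P.informedOfHistory v₀ t h))).comp
    (measurable_history t)

variable [NeZero n]

instance processLaw.instIsProbabilityMeasure : IsProbabilityMeasure (processLaw n p) := by
  unfold processLaw
  infer_instance

theorem integrable_comp_informed (v₀ : Fin n) (t : ℕ) (f : Finset (Fin n) → ℝ) :
    Integrable (fun ω => f (P.informed v₀ ω t)) (processLaw n p) := by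
  obtain ⟨C, hC⟩ := (Set.finite_range fun S => ‖f S‖).bddAbove
  exact Integrable.of_bound (P.measurable_comp_informed v₀ t f).aestronglyMeasurable C
    (ae_of_all _ fun ω => hC ⟨_, rfl⟩)

/-- The calls of a round are independent of the nodes informed before it. -/
theorem integral_comp_informed_succ (v₀ : Fin n) (t : ℕ) (f : Finset (Fin n) → ℝ) :
    ∫ ω, f (P.informed v₀ ω (t + 1)) ∂(processLaw n p) =
      ∫ ω, ∫ c, f (P.step (P.informed v₀ ω t) c) ∂(roundLaw n p) ∂(processLaw n p) := by
  let X : (ℕ → Calls n) → (Finset.range t → Calls n) := fun ω i => ω i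
  let Y : (ℕ → Calls n) → Calls n := fun ω => ω t
  have hX : Measurable X := measurable_history t
  have hY : Measurable Y := measurable_pi_apply t
  have hind : IndepFun X Y (processLaw n p) := by
    have h1 : iIndepFun (fun (i : ℕ) (ω : ℕ → Calls n) => ω i) (processLaw n p) :=
      iIndepFun_infinitePi (X := fun _ c => c) fun _ => measurable_id
    have h2 := h1.indepFun_finset (Finset.range t) {t} (by simp) (fun i => measurable_pi_apply i)
    exact h2.comp measurable_id
      (measurable_pi_apply (⟨t, Finset.mem_singleton_self t⟩ : ({t} : Finset ℕ)))
  have hYlaw : (processLaw n p).map Y = roundLaw n p := by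
    unfold processLaw
    exact Measure.infinitePi_map_eval _ t
  have hprod : (processLaw n p).map (fun ω => (X ω, Y ω)) =
      ((processLaw n p).map X).prod (roundLaw n p) := by
    rw [← hYlaw]
    exact hind.map_prod_eq_prod_map_map hX.aemeasurable hY.aemeasurable
  have : IsProbabilityMeasure ((processLaw n p).map X) :=
    Measure.isProbabilityMeasure_map hX.aemeasurable
  let φ : (Finset.range t → Calls n) × Calls n → ℝ :=
    fun z => f (P.step (P.informedOfHistory v₀ t z.1) z.2)
  have hφ : Integrable φ (((processLaw n p).map X).prod (roundLaw n p)) := Integrable.of_finite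
  calc ∫ ω, f (P.informed v₀ ω (t + 1)) ∂(processLaw n p)
      = ∫ ω, φ (X ω, Y ω) ∂(processLaw n p) := by
        congr 1 with ω
        simp only [informed_succ, P.informed_eq_informedOfHistory v₀ ω t, φ, X, Y]
    _ = ∫ z, φ z ∂((processLaw n p).map fun ω => (X ω, Y ω)) :=
        (integral_map (hX.prodMk hY).aemeasurable
          (measurable_of_finite φ).aestronglyMeasurable).symm
    _ = ∫ x, ∫ c, φ (x, c) ∂(roundLaw n p) ∂((processLaw n p).map X) := by
        rw [hprod, integral_prod _ hφ]
    _ = ∫ ω, ∫ c, φ (X ω, c) ∂(roundLaw n p) ∂(processLaw n p) :=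
        integral_map hX.aemeasurable (measurable_of_finite _).aestronglyMeasurable
    _ = _ := by
        congr 1 with ω
        simp only [P.informed_eq_informedOfHistory v₀ ω t, φ, X]

/-- The probability that some node is uninformed after `t` rounds. -/
noncomputable def unfinishedProb (v₀ : Fin n) (t : ℕ) : ℝ :=
  (processLaw n p).real {ω | P.informed v₀ ω t ≠ Finset.univ}

open Classical in
theorem unfinishedProb_eq_integral (v₀ : Fin n) (t : ℕ) :
    P.unfinishedProb p v₀ t =
      ∫ ω, (if P.informed v₀ ω t ≠ Finset.univ then (1 : ℝ) else 0) ∂(processLaw n p) := by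
  have hm : MeasurableSet {ω : ℕ → Calls n | P.informed v₀ ω t ≠ Finset.univ} :=
    measurableSet_setOfPred.mpr (P.measurable_comp_informed v₀ t (fun S => S ≠ Finset.univ))
  rw [unfinishedProb, ← integral_indicator_one hm]
  congr 1 with ω
  simp [Set.indicator_apply]

omit [NeZero n] in
theorem spreadingTime_eq_tsum (v₀ : Fin n) (ω : ℕ → Calls n) :
    ((P.spreadingTime v₀ ω : ℕ∞) : ENNReal) =
      ∑' t, {ω | P.informed v₀ ω t ≠ Finset.univ}.indicator 1 ω := by
  classical
  by_cases h : ∃ t, P.informed v₀ ω t = Finset.univ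
  · have hiff : ∀ t, P.informed v₀ ω t = Finset.univ ↔ Nat.find h ≤ t := fun t =>
      ⟨fun ht => Nat.find_min' h ht, fun ht => Finset.univ_subset_iff.mp
        ((Nat.find_spec h).symm.le.trans (P.informed_mono v₀ ω ht))⟩
    have hT : P.spreadingTime v₀ ω = (Nat.find h : ℕ∞) := by
      refine le_antisymm (iInf₂_le (Nat.find h) (Nat.find_spec h)) (le_iInf₂ fun t ht => ?_)
      exact_mod_cast (hiff t).mp ht
    rw [hT, tsum_eq_sum (s := Finset.range (Nat.find h))]
    · rw [Finset.sum_congr rfl (g := fun _ => 1)]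
      · simp
      · intro t ht
        rw [Set.indicator_of_mem]
        · rfl
        · exact fun h' => absurd ((hiff t).mp h') (by simpa using ht)
    · intro t ht
      rw [Set.indicator_of_notMem]
      exact fun h' => h' ((hiff t).mpr (by simpa using ht))
  · push Not at h
    have hT : P.spreadingTime v₀ ω = ⊤ := by simp [spreadingTime, h]
    simp [hT, h]

theorem expectedTime_eq_tsum (v₀ : Fin n) :
    P.expectedTime p v₀ = ∑' t, ENNReal.ofReal (P.unfinishedProb p v₀ t) := by
  have hm : ∀ t, MeasurableSet {ω : ℕ → Calls n | P.informed v₀ ω t ≠ Finset.univ} := fun t =>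
    measurableSet_setOfPred.mpr (P.measurable_comp_informed v₀ t (fun S => S ≠ Finset.univ))
  simp only [expectedTime, spreadingTime_eq_tsum]
  rw [lintegral_tsum fun t => (measurable_one.indicator (hm t)).aemeasurable]
  congr 1 with t
  rw [lintegral_indicator_one (hm t), unfinishedProb, ofReal_measureReal]

theorem unfinishedProb_nonneg (v₀ : Fin n) (t : ℕ) : 0 ≤ P.unfinishedProb p v₀ t :=
  measureReal_nonneg

/-- A potential that decreases in expectation by at least one in each round. -/
theorem sum_unfinishedProb_le (v₀ : Fin n) {f : Finset (Fin n) → ℝ}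
    (hf : ∀ S : Finset (Fin n), S.Nonempty → S ≠ Finset.univ →
      ∫ c, f (P.step S c) ∂(roundLaw n p) ≤ f S - 1) (N : ℕ) :
    ∑ t ∈ Finset.range N, P.unfinishedProb p v₀ t +
      ∫ ω, f (P.informed v₀ ω N) ∂(processLaw n p) ≤ f {v₀} := by
  classical
  induction N with
  | zero => simp [informed]
  | succ N ih =>
    rw [Finset.sum_range_succ, integral_comp_informed_succ]
    have hstep : ∀ ω, ∫ c, f (P.step (P.informed v₀ ω N) c) ∂(roundLaw n p) ≤
        f (P.informed v₀ ω N) - if P.informed v₀ ω N ≠ Finset.univ then 1 else 0 := by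
      intro ω
      by_cases h : P.informed v₀ ω N = Finset.univ
      · simp [h, step_univ]
      · simpa [h] using hf _ (P.informed_nonempty v₀ ω N) h
    have := integral_mono
      (P.integrable_comp_informed p v₀ N fun S => ∫ c, f (P.step S c) ∂(roundLaw n p))
      ((P.integrable_comp_informed p v₀ N f).sub
        (P.integrable_comp_informed p v₀ N fun S => if S ≠ Finset.univ then (1 : ℝ) else 0)) hstep
    simp only [Pi.sub_apply] at this
    rw [integral_sub (P.integrable_comp_informed p v₀ N f)
      (P.integrable_comp_informed p v₀ N fun S => if S ≠ Finset.univ then (1 : ℝ) else 0),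
      ← unfinishedProb_eq_integral] at this
    linarith

/-- A potential that decreases in expectation by at most one in each round. -/
theorem le_sum_unfinishedProb (v₀ : Fin n) {g : Finset (Fin n) → ℝ}
    (hg : ∀ S : Finset (Fin n), S.Nonempty → S ≠ Finset.univ →
      ∫ c, -g (P.step S c) ∂(roundLaw n p) ≤ -g S + 1) (N : ℕ) :
    g {v₀} ≤ ∑ t ∈ Finset.range N, P.unfinishedProb p v₀ t +
      ∫ ω, g (P.informed v₀ ω N) ∂(processLaw n p) := by
  classical
  induction N with
  | zero => simp [informed]
  | succ N ih =>
    rw [Finset.sum_range_succ, integral_comp_informed_succ]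
    have hstep : ∀ ω, g (P.informed v₀ ω N) -
        (if P.informed v₀ ω N ≠ Finset.univ then 1 else 0) ≤
        ∫ c, g (P.step (P.informed v₀ ω N) c) ∂(roundLaw n p) := by
      intro ω
      by_cases h : P.informed v₀ ω N = Finset.univ
      · simp [h, step_univ]
      · have := hg _ (P.informed_nonempty v₀ ω N) h
        rw [integral_neg] at this
        simp only [ne_eq, h, not_false_eq_true, if_true]
        linarith
    have := integral_mono
      ((P.integrable_comp_informed p v₀ N g).sub
        (P.integrable_comp_informed p v₀ N fun S => if S ≠ Finset.univ then (1 : ℝ) else 0))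
      (P.integrable_comp_informed p v₀ N fun S => ∫ c, g (P.step S c) ∂(roundLaw n p)) hstep
    simp only [Pi.sub_apply] at this
    rw [integral_sub (P.integrable_comp_informed p v₀ N g)
      (P.integrable_comp_informed p v₀ N fun S => if S ≠ Finset.univ then (1 : ℝ) else 0),
      ← unfinishedProb_eq_integral] at this
    linarith

/-- Additive drift: two potentials bound the expected spreading time. -/
theorem expectedTime_bounds (v₀ : Fin n) {f g : Finset (Fin n) → ℝ} {C : ℝ}
    (hfC : ∀ S, S.Nonempty → -C ≤ f S)
    (hf : ∀ S : Finset (Fin n), S.Nonempty → S ≠ Finset.univ →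
      ∫ c, f (P.step S c) ∂(roundLaw n p) ≤ f S - 1)
    (hg : ∀ S : Finset (Fin n), S.Nonempty → S ≠ Finset.univ →
      ∫ c, -g (P.step S c) ∂(roundLaw n p) ≤ -g S + 1) :
    P.expectedTime p v₀ ≠ ⊤ ∧ g {v₀} - g Finset.univ ≤ (P.expectedTime p v₀).toReal ∧
      (P.expectedTime p v₀).toReal ≤ f {v₀} + C := by
  classical
  have hle : ∀ N, ∑ t ∈ Finset.range N, P.unfinishedProb p v₀ t ≤ f {v₀} + C := fun N => by
    have h1 := P.sum_unfinishedProb_le p v₀ hf N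
    have h2 := integral_mono (integrable_const (-C)) (P.integrable_comp_informed p v₀ N f)
      fun ω => hfC _ (P.informed_nonempty v₀ ω N)
    rw [integral_const, probReal_univ, one_smul] at h2
    linarith
  have hsum : Summable (P.unfinishedProb p v₀) :=
    summable_of_sum_range_le (P.unfinishedProb_nonneg p v₀) hle
  have hE : P.expectedTime p v₀ = ENNReal.ofReal (∑' t, P.unfinishedProb p v₀ t) := by
    rw [expectedTime_eq_tsum, ENNReal.ofReal_tsum_of_nonneg (P.unfinishedProb_nonneg p v₀) hsum]
  have hE' : (P.expectedTime p v₀).toReal = ∑' t, P.unfinishedProb p v₀ t := by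
    rw [hE, ENNReal.toReal_ofReal (tsum_nonneg (P.unfinishedProb_nonneg p v₀))]
  refine ⟨by rw [hE]; exact ENNReal.ofReal_ne_top, ?_, ?_⟩
  · obtain ⟨M, hM⟩ := (Set.finite_range fun S => g S - g Finset.univ).bddAbove
    have hbound : ∀ N, g {v₀} - g Finset.univ - M * P.unfinishedProb p v₀ N ≤
        (P.expectedTime p v₀).toReal := fun N => by
      have h1 := P.le_sum_unfinishedProb p v₀ hg N
      have h2 := hsum.sum_le_tsum (Finset.range N) fun t _ => P.unfinishedProb_nonneg p v₀ t
      have h3 : ∫ ω, g (P.informed v₀ ω N) ∂(processLaw n p) ≤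
          ∫ ω, (g Finset.univ + M * if P.informed v₀ ω N ≠ Finset.univ then 1 else 0)
            ∂(processLaw n p) := by
        refine integral_mono (P.integrable_comp_informed p v₀ N g)
          (P.integrable_comp_informed p v₀ N fun S =>
            g Finset.univ + M * if S ≠ Finset.univ then 1 else 0) fun ω => ?_
        by_cases h : P.informed v₀ ω N = Finset.univ
        · simp [h]
        · have := hM ⟨P.informed v₀ ω N, rfl⟩
          simp only [ne_eq, h, not_false_eq_true, if_true]
          dsimp only at this
          linarith
      rw [integral_add (integrable_const _) ((P.integrable_comp_informed p v₀ N fun S =>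
        if S ≠ Finset.univ then (1 : ℝ) else 0).const_mul M), integral_const_mul,
        ← unfinishedProb_eq_integral, integral_const, probReal_univ, one_smul] at h3
      rw [hE']
      linarith
    have hlim : Tendsto (fun N => g {v₀} - g Finset.univ - M * P.unfinishedProb p v₀ N) atTop
        (nhds (g {v₀} - g Finset.univ - M * 0)) :=
      (hsum.tendsto_atTop_zero.const_mul M).const_sub _
    rw [mul_zero, sub_zero] at hlim
    exact le_of_tendsto' hlim hbound
  · rw [hE']
    exact hsum.tsum_le_of_sum_range_le hle

theorem roundBounds {γ ρ : ℝ} (hγ : 0 < γ) (hρ : 0 < ρ)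
    (hγP : γ = P.pushRate p + P.pullRate p)
    (hρP : Real.exp (-ρ) = Real.exp (-P.pushRate p) * (1 - P.pullRate p))
    {S : Finset (Fin n)} (hS : S.Nonempty) (hS' : S ≠ Finset.univ) :
    RoundBounds γ ρ S.card Sᶜ.card
      (1 - stayRate (P.pushRate p) (P.pullRate p) n S.card S.card) := by
  obtain ⟨x, hx⟩ : ∃ x, x ∉ S := by
    by_contra! h
    exact hS' (Finset.eq_univ_iff_forall.mpr h)
  have hk : (S.card : ℝ) + Sᶜ.card = n := by rw [card_compl_cast]; ring
  have ha := P.pushRate_nonneg p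
  have ha1 := P.pushRate_le_one p
  have hb := P.pullRate_nonneg p
  have hb1 := P.pullRate_le_one p
  have hn := one_le_cast n
  have hj := card_add_one_le hx
  refine ⟨hγ, hρ, by exact_mod_cast hS.card_pos, by rw [card_compl_cast]; linarith, ?_, ?_, ?_, ?_,
    ?_⟩
  · rw [hk, hγP]; exact one_sub_stayRate_le ha ha1 hb hb1 hn hj
  · rw [hk, hγP]; exact one_sub_stayRate_ge ha ha1 hb hb1 hn hj
  · rw [hk, hγP]; exact half_mul_le_one_sub_stayRate ha ha1 hb hb1 hn hj
  · rw [hρP, sub_sub_cancel]; exact le_stayRate ha ha1 hb hb1 hn hj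
  · rw [hk, hρP, sub_sub_cancel, card_compl_cast]; exact stayRate_le ha ha1 hb hb1 hn hj

theorem integral_le_of_quadBound {S : Finset (Fin n)} {F : ℝ → ℝ} {r s : ℝ}
    (hs : s = 1 - stayRate (P.pushRate p) (P.pullRate p) n S.card S.card)
    (hF : QuadBound Sᶜ.card (Sᶜ.card * (1 - s)) (Sᶜ.card * s * (1 - s)) F r) :
    ∫ c, F (P.uninformedAfter S c) ∂(roundLaw n p) ≤ r := by
  have hq : 1 - s = stayRate (P.pushRate p) (P.pullRate p) n S.card S.card := by linarith
  refine hF.integral_le (P.uninformedAfter_nonneg S) (P.uninformedAfter_le S) ?_ ?_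
  · rw [hq, integral_uninformedAfter]
  · have := P.integral_uninformedAfter_sub_sq_le p S hq
    rwa [sub_sub_cancel] at this

omit [NeZero n] in
theorem expectedTimeEq_of_rates {γ ρ : ℝ} (hγ : 0 < γ) (hρ : 0 < ρ)
    (hγP : γ = P.pushRate p + P.pullRate p)
    (hρP : Real.exp (-ρ) = Real.exp (-P.pushRate p) * (1 - P.pullRate p)) :
    P.ExpectedTimeEq p (fun n => Real.logb (1 + γ) n + 1 / ρ * Real.log n) := by
  have hA := growthCoeff_pos hγ
  have hL := linearCoeff_pos hγ hρ
  have hE := Real.exp_pos ρ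
  have hB : 0 < 1 / ρ * Real.exp ρ := by positivity
  refine ⟨growthCoeff γ * (2 + γ) + linearCoeff γ ρ + 8 * (1 / ρ * Real.exp ρ),
    fun n _ v₀ => ?_⟩
  have hn := one_le_cast n
  have hcard : ∀ S : Finset (Fin n), S.Nonempty → (Sᶜ.card : ℝ) + 1 ≤ n := fun S hS => by
    have : (1 : ℝ) ≤ S.card := by exact_mod_cast hS.card_pos
    rw [card_compl_cast]
    linarith
  have hk : ∀ S : Finset (Fin n), (n : ℝ) = S.card + Sᶜ.card := fun S => by
    rw [card_compl_cast]; ring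
  have hv₀ : ((({v₀} : Finset (Fin n))ᶜ.card : ℕ) : ℝ) = n - 1 := by
    rw [card_compl_cast]; simp
  obtain ⟨htop, hlow, hupp⟩ := P.expectedTime_bounds p v₀
    (f := fun S => upperPotential γ ρ n Sᶜ.card) (g := fun S => lowerPotential γ ρ n Sᶜ.card)
    (fun S hS => upperPotential_ge hγ hρ (Nat.cast_nonneg _) (hcard S hS))
    (fun S hS hS' => P.integral_le_of_quadBound p rfl
      (quadBound_upperPotential (P.roundBounds p hγ hρ hγP hρP hS hS') (hk S)))
    (fun S hS hS' => P.integral_le_of_quadBound (F := fun z => -lowerPotential γ ρ n z) p rfl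
      (quadBound_neg_lowerPotential (P.roundBounds p hγ hρ hγP hρP hS hS') (hk S)))
  refine ⟨htop, ?_⟩
  simp only [hv₀, Finset.compl_univ, Finset.card_empty, Nat.cast_zero,
    lowerPotential_zero] at hlow hupp
  have h1 := upperPotential_start_le hγ hρ hn
  have h2 := lowerPotential_start_ge hγ hρ hn
  have hlog : Real.logb (1 + γ) n = growthCoeff γ * Real.log n := by
    rw [Real.logb, growthCoeff]; ring
  have h3 : 0 < growthCoeff γ * (2 + γ) := by positivity
  dsimp only
  rw [hlog, abs_le]
  constructor <;> linarith

omit [NeZero n] in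
/-- The expected spreading time and the exponential shrinking conditions in terms of the rates. -/
theorem spreading_of_rates {γ ρ : ℝ} (hγ : 0 < γ) (hρ : 0 < ρ)
    (hγP : γ = P.pushRate p + P.pullRate p)
    (hρP : Real.exp (-ρ) = Real.exp (-P.pushRate p) * (1 - P.pullRate p)) :
    P.ExpectedTimeEq p (fun n => Real.logb (1 + γ) n + 1 / ρ * Real.log n) ∧
      P.UpperExpShrinking p ρ ∧ P.LowerExpShrinking p ρ :=
  ⟨P.expectedTimeEq_of_rates p hγ hρ hγP hρP, P.upperExpShrinking_of_rate p hρ hρP,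
    P.lowerExpShrinking_of_rate p hρ hρP⟩

end SpreadingProtocol

theorem mainTheorem8 (p : unitInterval) (hp : 0 < (p : ℝ)) :
    (SpreadingProtocol.push.ExpectedTimeEq p
        (fun n => Real.logb (1 + p) n + 1 / (p : ℝ) * Real.log n) ∧
      SpreadingProtocol.push.UpperExpShrinking p p ∧
      SpreadingProtocol.push.LowerExpShrinking p p) ∧
    ((p : ℝ) < 1 →
      (SpreadingProtocol.pull.ExpectedTimeEq p
          (fun n => Real.logb (1 + p) n + 1 / Real.log (1 / (1 - p)) * Real.log n) ∧
        SpreadingProtocol.pull.UpperExpShrinking p (Real.log (1 / (1 - p))) ∧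
        SpreadingProtocol.pull.LowerExpShrinking p (Real.log (1 / (1 - p))) ∧
        ¬ SpreadingProtocol.pull.UpperDoubleExpShrinking p) ∧
      (SpreadingProtocol.pushPull.ExpectedTimeEq p
          (fun n => Real.logb (1 + 2 * p) n + 1 / (p + Real.log (1 / (1 - p))) * Real.log n) ∧
        SpreadingProtocol.pushPull.UpperExpShrinking p (p + Real.log (1 / (1 - p))) ∧
        SpreadingProtocol.pushPull.LowerExpShrinking p (p + Real.log (1 / (1 - p))) ∧
        ¬ SpreadingProtocol.pushPull.UpperDoubleExpShrinking p)) := by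
  refine ⟨SpreadingProtocol.push.spreading_of_rates p hp hp
    (by simp [SpreadingProtocol.pushRate, SpreadingProtocol.pullRate])
    (by simp [SpreadingProtocol.pushRate, SpreadingProtocol.pullRate]), fun hp1 => ?_⟩
  have h1p : 0 < 1 - (p : ℝ) := by linarith
  have hlog : 0 < Real.log (1 / (1 - (p : ℝ))) := by
    refine Real.log_pos ?_
    rw [lt_div_iff₀ h1p]
    linarith
  have hexp : Real.exp (-Real.log (1 / (1 - (p : ℝ)))) = 1 - p := by
    rw [one_div, Real.log_inv, neg_neg, Real.exp_log h1p]
  obtain ⟨h1, h2, h3⟩ := SpreadingProtocol.pull.spreading_of_rates p hp hlog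
    (by simp [SpreadingProtocol.pushRate, SpreadingProtocol.pullRate])
    (by simpa [SpreadingProtocol.pushRate, SpreadingProtocol.pullRate] using hexp)
  obtain ⟨h4, h5, h6⟩ := SpreadingProtocol.pushPull.spreading_of_rates p
    (γ := 2 * p) (ρ := p + Real.log (1 / (1 - p))) (by linarith) (by linarith) (two_mul _)
    (by rw [neg_add, Real.exp_add, hexp]; rfl)
  exact ⟨⟨h1, h2, h3, SpreadingProtocol.pull.not_upperDoubleExpShrinking p hp1⟩,
    h4, h5, h6, SpreadingProtocol.pushPull.not_upperDoubleExpShrinking p hp1⟩
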